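/- An instance of Equitable Coloring consists of a finite simple graph $G$ on $n$ vertices and an integer $k$; the question is whether $G$ has a proper coloring with $k$ colors in which every color is used at least $\lfloor n/k\rfloor$ and at most $\lceil n/k\rceil$ times. A cluster graph is a graph in which every connected component is a clique, and the distance to cluster $\mathrm{dc}(G)$ is the least size of a set $U\subseteq V(G)$ such that $G-U$ is a cluster graph. Theorem. Equitable Coloring parameterized by the distance to cluster is fixed-parameter tractable: there are a computable function $f$, a constant $c$ and an algorithm (a program of a random access machine with unit-cost addition and subtraction) that, given only $(G,k)$ as a binary word $x$ (the adjacency matrix of $G$ and $k$ in binary), decides whether $G$ has an equitable $k$-coloring in at most $f(\mathrm{dc}(G))\cdot(|x|+1)^{c}$ steps. Moreover, this holds with $f(d)=2^{O(d\log d)}$; more precisely, with $f(d)=a\cdot d^{\,a d}$ for some constant $a$ (where $0^0=1$). -/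

import Mathlib

/-! ### Random access machines with unit cost -/

namespace RAM

/-- The memory of a random access machine: one natural number in each of the registers
`0, 1, 2, …`. -/
abbrev Mem : Type := ℕ → ℕ

/-- Arithmetic expressions: literals, the contents of the register whose address is given by an
expression (direct and indirect addressing), addition and cut-off subtraction. There is no
multiplication, so that uniform cost is polynomially equivalent to Turing machine time. -/
inductive Expr : Type
  | const (n : ℕ) : Expr
  | read (addr : Expr) : Expr
  | add (a b : Expr) : Expr
  | sub (a b : Expr) : Expr

namespace Expr

/-- The value of an expression. -/
def eval (m : Mem) : Expr → ℕ
  | const n => n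
  | read a => m (a.eval m)
  | add a b => a.eval m + b.eval m
  | sub a b => a.eval m - b.eval m

/-- The number of elementary operations needed to evaluate an expression. -/
def cost : Expr → ℕ
  | const _ => 1
  | read a => a.cost + 1
  | add a b => a.cost + b.cost + 1
  | sub a b => a.cost + b.cost + 1

end Expr

/-- Programs of the random access machine, with structured control flow. A test succeeds when
the tested expression is nonzero. -/
inductive Prog : Type
  | skip : Prog
  | store (addr val : Expr) : Prog
  | seq (p q : Prog) : Prog
  | ite (e : Expr) (p q : Prog) : Prog
  | loop (e : Expr) (p : Prog) : Prog

/-- `Runs p m t m'`: started on the memory `m`, the program `p` halts after exactly `t` steps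
with the memory `m'`. Every elementary operation, every store and every test takes one step;
`loop e p` is the loop `while e ≠ 0 do p`. -/
inductive Runs : Prog → Mem → ℕ → Mem → Prop
  | skip (m : Mem) : Runs Prog.skip m 1 m
  | store (a e : Expr) (m : Mem) :
      Runs (Prog.store a e) m (a.cost + e.cost + 1) (Function.update m (a.eval m) (e.eval m))
  | seq {p q : Prog} {m m' m'' : Mem} {t t' : ℕ} :
      Runs p m t m' → Runs q m' t' m'' → Runs (Prog.seq p q) m (t + t') m''
  | ite_true {e : Expr} {p q : Prog} {m m' : Mem} {t : ℕ} :
      e.eval m ≠ 0 → Runs p m t m' → Runs (Prog.ite e p q) m (e.cost + 1 + t) m'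
  | ite_false {e : Expr} {p q : Prog} {m m' : Mem} {t : ℕ} :
      e.eval m = 0 → Runs q m t m' → Runs (Prog.ite e p q) m (e.cost + 1 + t) m'
  | loop_done {e : Expr} {p : Prog} {m : Mem} :
      e.eval m = 0 → Runs (Prog.loop e p) m (e.cost + 1) m
  | loop_step {e : Expr} {p : Prog} {m m' m'' : Mem} {t t' : ℕ} :
      e.eval m ≠ 0 → Runs p m t m' → Runs (Prog.loop e p) m' t' m'' →
        Runs (Prog.loop e p) m (e.cost + 1 + t + t') m''

/-- The machine is deterministic: a program has at most one halting computation on a memory. -/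
theorem Runs.unique {p : Prog} {m m₁ : Mem} {t₁ : ℕ} (h₁ : Runs p m t₁ m₁) :
    ∀ {m₂ : Mem} {t₂ : ℕ}, Runs p m t₂ m₂ → t₁ = t₂ ∧ m₁ = m₂ := by
  induction h₁ with
  | skip m => intro _ _ h; cases h; exact ⟨rfl, rfl⟩
  | store a e m => intro _ _ h; cases h; exact ⟨rfl, rfl⟩
  | seq _ _ ih ih' =>
    intro _ _ h
    cases h with
    | seq g g' =>
      obtain ⟨rfl, rfl⟩ := ih g
      obtain ⟨rfl, rfl⟩ := ih' g'
      exact ⟨rfl, rfl⟩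
  | ite_true he _ ih =>
    intro _ _ h
    cases h with
    | ite_true _ g => obtain ⟨rfl, rfl⟩ := ih g; exact ⟨rfl, rfl⟩
    | ite_false he' _ => exact absurd he' he
  | ite_false he _ ih =>
    intro _ _ h
    cases h with
    | ite_true he' _ => exact absurd he he'
    | ite_false _ g => obtain ⟨rfl, rfl⟩ := ih g; exact ⟨rfl, rfl⟩
  | loop_done he =>
    intro _ _ h
    cases h with
    | loop_done _ => exact ⟨rfl, rfl⟩
    | loop_step he' _ _ => exact absurd he he'
  | loop_step he _ _ ih ih' =>
    intro _ _ h
    cases h with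
    | loop_done he' => exact absurd he' he
    | loop_step _ g g' =>
      obtain ⟨rfl, rfl⟩ := ih g
      obtain ⟨rfl, rfl⟩ := ih' g'
      exact ⟨rfl, rfl⟩

/-- The initial memory on a binary input word: register `0` holds the length of the word,
register `i + 1` its letter number `i` (counted from `0`), all other registers hold `0`. -/
def initMem (w : List Bool) : Mem
  | 0 => w.length
  | i + 1 => (w.getD i false).toNat

/-- On the input word `w` the program halts after at most `T` steps, with a `1` in register `0`
if `P` holds (the machine accepts) and with a `0` there otherwise (it rejects). -/
def AnswersWithin (p : Prog) (w : List Bool) (P : Prop) (T : ℕ) : Prop :=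
  ∃ t m', t ≤ T ∧ Runs p (initMem w) t m' ∧ ((P ∧ m' 0 = 1) ∨ (¬ P ∧ m' 0 = 0))

end RAM

/-! ### Parameterized problems -/

/-- A parameterized decision problem: instances, written down as binary words, the set of
yes-instances, and the parameter. The parameter is not part of the input word. -/
structure ParamProblem where
  Instance : Type
  encode : Instance → List Bool
  encode_injective : Function.Injective encode
  IsYes : Instance → Prop
  param : Instance → ℕ

namespace ParamProblem

/-- The problem is decided by one random access machine in time `f(κ) · |x|^O(1)`, where `κ` is
the parameter and `|x|` the length of the input word. -/
def SolvableWith (Q : ParamProblem) (f : ℕ → ℕ) : Prop :=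
  ∃ (p : RAM.Prog) (c : ℕ), ∀ x : Q.Instance,
    RAM.AnswersWithin p (Q.encode x) (Q.IsYes x)
      (f (Q.param x) * ((Q.encode x).length + 1) ^ c)

/-- Fixed-parameter tractability. -/
def IsFPT (Q : ParamProblem) : Prop :=
  ∃ f : ℕ → ℕ, Computable f ∧ Q.SolvableWith f

end ParamProblem

/-! ### Equitable colorings and the distance to cluster -/

namespace SimpleGraph

/-- `G` has a proper coloring with `k` colors in which every color is used at least `⌊n / k⌋`
and at most `⌈n / k⌉` times, `n` being the number of vertices. -/
def EquitablyColorable {V : Type*} [Fintype V] (G : SimpleGraph V) (k : ℕ) : Prop :=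
  ∃ φ : G.Coloring (Fin k), ∀ i : Fin k,
    Fintype.card V / k ≤ {v : V | φ v = i}.ncard ∧
      {v : V | φ v = i}.ncard ≤ Fintype.card V ⌈/⌉ k

/-- A cluster graph: every connected component is a clique. -/
def IsCluster {V : Type*} (G : SimpleGraph V) : Prop :=
  ∀ C : G.ConnectedComponent, G.IsClique C.supp

/-- The distance to cluster: the least size of a set of vertices whose removal leaves a cluster
graph. -/
noncomputable def distToCluster {V : Type*} [Fintype V] (G : SimpleGraph V) : ℕ :=
  sInf {d : ℕ | ∃ U : Finset V, U.card = d ∧ (G.induce ((U : Set V)ᶜ)).IsCluster}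

end SimpleGraph

/-! ### The problem Equitable Coloring, parameterized by the distance to cluster -/

/-- An instance of Equitable Coloring: a finite graph, with vertices `0, …, n - 1`, and the number
of colors. -/
structure EqColInstance where
  n : ℕ
  G : SimpleGraph (Fin n)
  k : ℕ

namespace EqColInstance

open Classical in
/-- The adjacency matrix, row by row. -/
noncomputable def adjBits {n : ℕ} (G : SimpleGraph (Fin n)) : List Bool :=
  (List.finRange n).flatMap fun i => (List.finRange n).map fun j => decide (G.Adj i j)

/-- The input word: `n` in unary, a separating `0`, the adjacency matrix, and the number of
colors in binary (least significant bit first). -/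
noncomputable def encode (x : EqColInstance) : List Bool :=
  List.replicate x.n true ++ false :: (adjBits x.G ++ x.k.bits)

theorem replicate_append_inj {a b : ℕ} {u v : List Bool}
    (h : List.replicate a true ++ false :: u = List.replicate b true ++ false :: v) :
    a = b ∧ u = v := by
  induction a generalizing b with
  | zero =>
    cases b with
    | zero => simpa using h
    | succ b => simp [List.replicate_succ] at h
  | succ a ih =>
    cases b with
    | zero => simp [List.replicate_succ] at h
    | succ b =>
      simp only [List.replicate_succ, List.cons_append, List.cons.injEq, true_and] at h
      obtain ⟨rfl, rfl⟩ := ih h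
      exact ⟨rfl, rfl⟩

theorem length_adjBits {n : ℕ} (G : SimpleGraph (Fin n)) : (adjBits G).length = n * n := by
  simp [adjBits, List.length_flatMap]

theorem adjBits_injective {n : ℕ} :
    Function.Injective (adjBits : SimpleGraph (Fin n) → List Bool) := by
  classical
  intro G H h
  have key : ∀ (l : List (Fin n)) (f g : Fin n → Fin n → Bool),
      (l.flatMap fun i => (List.finRange n).map (f i)) =
        (l.flatMap fun i => (List.finRange n).map (g i)) → ∀ i ∈ l, ∀ j, f i j = g i j := by
    intro l f g
    induction l with
    | nil => simp
    | cons a l ih =>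
      intro h
      simp only [List.flatMap_cons] at h
      obtain ⟨h₁, h₂⟩ := List.append_inj h (by simp)
      intro i hi j
      rcases List.mem_cons.mp hi with rfl | hi
      · exact List.map_inj_left.mp h₁ j (List.mem_finRange j)
      · exact ih h₂ i hi j
  ext i j
  simpa using key _ _ _ h i (List.mem_finRange i) j

theorem bits_injective : Function.Injective Nat.bits := by
  intro a
  induction a using Nat.binaryRec' with
  | zero =>
    intro b
    induction b using Nat.binaryRec' with
    | zero => simp
    | bit c b hb _ => simp [Nat.bits_append_bit b c hb]
  | bit d a ha ih =>
    intro b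
    induction b using Nat.binaryRec' with
    | zero => simp [Nat.bits_append_bit a d ha]
    | bit c b hb _ =>
      rw [Nat.bits_append_bit a d ha, Nat.bits_append_bit b c hb]
      intro h
      obtain ⟨rfl, h'⟩ := List.cons.inj h
      rw [ih h']

theorem encode_injective : Function.Injective encode := by
  rintro ⟨n, G, k⟩ ⟨n', G', k'⟩ h
  obtain ⟨h₁, h₂⟩ := replicate_append_inj h
  dsimp only at h₁ h₂
  subst h₁
  obtain ⟨h₃, h₄⟩ := List.append_inj h₂ (by rw [length_adjBits, length_adjBits])
  rw [adjBits_injective h₃, bits_injective h₄]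

end EqColInstance

/-- Equitable Coloring, parameterized by the distance to cluster of the input graph. -/
noncomputable def equitableColoringByDistToCluster : ParamProblem where
  Instance := EqColInstance
  encode := EqColInstance.encode
  encode_injective := EqColInstance.encode_injective
  IsYes x := x.G.EquitablyColorable x.k
  param x := x.G.distToCluster

/-!
Going through all triples of vertices, collect the vertices of pairwise disjoint induced paths on
three vertices, greedily. Every vertex set whose removal leaves a cluster graph meets each of these
paths, so the collected modulator `M` has `r ≤ 3 * dc(G)` vertices, and `G - M` is a disjoint union
of cliques.

Adding a disjoint clique makes all color classes have the same size `m = ⌈n / k⌉`, and after a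
permutation of the colors only the first `r` of them occur on `M`. There are at most `r ^ r` such
colorings of `M`; fix one. Its extensions with all color classes of size `m` are the colorings of
the cliques in which every color is missing from a prescribed number of cliques. Assigning to each
pair of a color and a clique either a vertex of the clique or one of the prescribed idle places of
the color is a bipartite matching problem. Minimizing over the pairs at each clique separately turns
Hall's condition for it into one inequality per set of colors. The colors from `r` on do not occur
on `M` and are therefore interchangeable, so that `2 ^ r * (k + 1)` of these sets suffice.

The running time is a polynomial in `r ^ r + 2 ^ r` and the input length, and `r ≤ 3 * dc(G)` turns
this into `a * d ^ (a * d)`.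
-/

/-! ### Coloring disjoint cliques -/

namespace CliqueColoring

open Finset

section Hall

variable {V ι κ : Type*} [Fintype V] (𝓒 : Finset (Finset κ)) (cl : V → ι) (ok : V → κ → Prop)
  (idle : κ → ℕ)

open Classical in
/-- The vertices of the clique `a` that may get one of the colors in `T`. Throughout, the cliques
are the fibers of `cl`, and `ok v c` says that the vertex `v` may get the color `c`. -/
noncomputable def candidates (a : ι) (T : Finset κ) : Finset V :=
  {v | cl v = a ∧ ∃ c ∈ T, ok v c}

open Classical in
/-- The least number of colors of `S` that are missing at the clique `a`, as far as the sets of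
colors in `𝓒` can tell. -/
noncomputable def deficiency (S : Finset κ) (a : ι) : ℕ :=
  {T ∈ 𝓒 | T ⊆ S}.sup fun T => #T - #(candidates cl ok a T)

/-- Hall's condition for coloring the cliques such that every color `c` is missing at exactly
`idle c` of them, tested on the sets of colors in `𝓒` only. -/
def HallCondition [Fintype ι] : Prop :=
  ∀ S ∈ 𝓒, ∑ a, deficiency 𝓒 cl ok S a ≤ ∑ c ∈ S, idle c

/-- A coloring of the cliques with allowed colors. -/
structure IsProper (cl : V → ι) (ok : V → κ → Prop) (φ : V → κ) : Prop where
  ok : ∀ v, ok v (φ v)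
  inj : ∀ u v, cl u = cl v → φ u = φ v → u = v

/-- A coloring of the cliques with allowed colors in which every color `c` is missing at exactly
`idle c` of them. -/
structure IsColoring [Fintype ι] (φ : V → κ) : Prop extends IsProper cl ok φ where
  ncard_add_idle : ∀ c, {v | φ v = c}.ncard + idle c = Fintype.card ι

variable {𝓒 cl ok idle}

@[simp]
theorem mem_candidates {a : ι} {T : Finset κ} {v : V} :
    v ∈ candidates cl ok a T ↔ cl v = a ∧ ∃ c ∈ T, ok v c := by
  simp [candidates]

theorem deficiency_le_iff {S : Finset κ} {a : ι} {n : ℕ} :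
    deficiency 𝓒 cl ok S a ≤ n ↔ ∀ T ∈ 𝓒, T ⊆ S → #T ≤ #(candidates cl ok a T) + n := by
  simp [deficiency, Finset.sup_le_iff, add_comm n]

theorem card_le_candidates_add_deficiency {S T : Finset κ} (hT : T ∈ 𝓒) (hTS : T ⊆ S) (a : ι) :
    #T ≤ #(candidates cl ok a T) + deficiency 𝓒 cl ok S a :=
  deficiency_le_iff.1 le_rfl T hT hTS

section Necessity

variable [Fintype ι] {φ : V → κ}

open Classical in
theorem IsColoring.deficiency_le_card_missing (hφ : IsColoring cl ok idle φ) (S : Finset κ)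
    (a : ι) : deficiency 𝓒 cl ok S a ≤ #{c ∈ S | ∀ v, cl v = a → φ v ≠ c} := by
  refine deficiency_le_iff.2 fun T _ hTS => ?_
  have hcover : T ⊆ (candidates cl ok a T).image φ ∪ {c ∈ S | ∀ v, cl v = a → φ v ≠ c} := by
    intro c hc
    by_cases hmissing : ∀ v, cl v = a → φ v ≠ c
    · exact mem_union_right _ (mem_filter.2 ⟨hTS hc, hmissing⟩)
    · push Not at hmissing
      obtain ⟨v, hva, rfl⟩ := hmissing
      exact mem_union_left _
        (mem_image_of_mem φ (mem_candidates.2 ⟨hva, φ v, hc, hφ.ok v⟩))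
  calc #T ≤ _ := card_le_card hcover
    _ ≤ _ := card_union_le _ _
    _ ≤ _ := Nat.add_le_add_right card_image_le _

open Classical in
theorem IsColoring.card_missing (hφ : IsColoring cl ok idle φ) (c : κ) :
    #{a | ∀ v, cl v = a → φ v ≠ c} = idle c := by
  have hpresent : #{a | ¬ ∀ v, cl v = a → φ v ≠ c} = {v | φ v = c}.ncard := by
    have hinj : Set.InjOn cl {v | φ v = c} := fun u hu v hv huv =>
      hφ.inj u v huv (Eq.trans hu (Eq.symm hv))
    rw [← hinj.ncard_image, ← Set.ncard_coe_finset]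
    congr
    ext a
    simp [and_comm]
  have htotal := card_filter_add_card_filter_not (s := univ) fun a => ∀ v, cl v = a → φ v ≠ c
  have := hφ.ncard_add_idle c
  rw [card_univ] at htotal
  lia

theorem IsColoring.hallCondition (hφ : IsColoring cl ok idle φ) :
    HallCondition 𝓒 cl ok idle := by
  classical
  intro S _
  calc ∑ a, deficiency 𝓒 cl ok S a
      ≤ ∑ a, #{c ∈ S | ∀ v, cl v = a → φ v ≠ c} :=
        sum_le_sum fun a _ => hφ.deficiency_le_card_missing S a
    _ = ∑ c ∈ S, #{a | ∀ v, cl v = a → φ v ≠ c} :=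
        sum_card_bipartiteAbove_eq_sum_card_bipartiteBelow fun a c => ∀ v, cl v = a → φ v ≠ c
    _ = ∑ c ∈ S, idle c := sum_congr rfl fun c _ => hφ.card_missing c

end Necessity

section Sufficiency

/-- A color can be placed at a clique either on a vertex of the clique or on one of the idle places
of the color. -/
def CanPlace (cl : V → ι) (ok : V → κ → Prop) (idle : κ → ℕ) (x : κ × ι) :
    V ⊕ (Σ c, Fin (idle c)) → Prop
  | .inl v => cl v = x.2 ∧ ok v x.1
  | .inr i => i.1 = x.1

variable [Fintype κ]

open Classical in
theorem sum_card_candidates_add_sum_idle [Fintype ι] (A : Finset (κ × ι)) :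
    ∑ a, #(candidates cl ok a {c | (c, a) ∈ A}) + ∑ c ∈ A.image Prod.fst, idle c =
      #{z | ∃ x ∈ A, CanPlace cl ok idle x z} := by
  have hplaces : ({z | ∃ x ∈ A, CanPlace cl ok idle x z} : Finset (V ⊕ Σ c, Fin (idle c))) =
      ({v | ∃ c, (c, cl v) ∈ A ∧ ok v c} : Finset V).disjSum
        ((A.image Prod.fst).sigma fun _ => univ) := by
    ext (v | i) <;> simp [CanPlace]
  rw [hplaces, card_disjSum, card_sigma]
  congr 1
  · rw [card_eq_sum_card_fiberwise (f := cl) (t := univ) fun _ _ => mem_coe.2 (mem_univ _)]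
    refine sum_congr rfl fun a _ => congrArg card ?_
    ext v
    simp only [mem_candidates, mem_filter, mem_univ, true_and]
    constructor
    · rintro ⟨rfl, h⟩
      exact ⟨h, rfl⟩
    · rintro ⟨h, rfl⟩
      exact ⟨rfl, h⟩
  · simp

open Classical in
theorem HallCondition.card_le_card_canPlace [Fintype ι] (h : HallCondition univ cl ok idle)
    (A : Finset (κ × ι)) : #A ≤ #{z | ∃ x ∈ A, CanPlace cl ok idle x z} := by
  have hA : #A = ∑ a, #({c | (c, a) ∈ A} : Finset κ) := by
    rw [card_eq_sum_card_fiberwise (f := Prod.snd) (t := univ) fun _ _ => mem_coe.2 (mem_univ _)]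
    refine sum_congr rfl fun a _ => ?_
    have hfiber : ({x ∈ A | x.2 = a} : Finset (κ × ι)) =
        ({c | (c, a) ∈ A} : Finset κ).map ⟨fun c => (c, a), Prod.mk_left_injective a⟩ := by
      aesop
    rw [hfiber, card_map]
  have hsub (a : ι) : ({c | (c, a) ∈ A} : Finset κ) ⊆ A.image Prod.fst := fun c hc =>
    mem_image_of_mem Prod.fst (mem_filter.1 hc).2
  calc #A ≤ ∑ a, (#(candidates cl ok a {c | (c, a) ∈ A}) +
        deficiency univ cl ok (A.image Prod.fst) a) := by
        rw [hA]
        exact sum_le_sum fun a _ => card_le_candidates_add_deficiency (mem_univ _) (hsub a) a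
    _ ≤ ∑ a, #(candidates cl ok a {c | (c, a) ∈ A}) + ∑ c ∈ A.image Prod.fst, idle c := by
        rw [sum_add_distrib]
        exact Nat.add_le_add_left (h _ (mem_univ _)) _
    _ = _ := sum_card_candidates_add_sum_idle A

theorem HallCondition.exists_equiv [Fintype ι] (h : HallCondition univ cl ok idle)
    (hcard : Fintype.card V + ∑ c, idle c = Fintype.card κ * Fintype.card ι) :
    ∃ e : κ × ι ≃ V ⊕ Σ c, Fin (idle c), ∀ x, CanPlace cl ok idle x (e x) := by
  classical
  obtain ⟨f, hinj, hf⟩ :=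
    (Fintype.all_card_le_filter_rel_iff_exists_injective (CanPlace cl ok idle)).1
      fun A => h.card_le_card_canPlace A
  have hbij : Function.Bijective f :=
    (Fintype.bijective_iff_injective_and_card f).2 ⟨hinj, by simp [hcard]⟩
  exact ⟨Equiv.ofBijective f hbij, hf⟩

theorem HallCondition.exists_isColoring [Fintype ι] (h : HallCondition univ cl ok idle)
    (hcard : Fintype.card V + ∑ c, idle c = Fintype.card κ * Fintype.card ι) :
    ∃ φ, IsColoring cl ok idle φ := by
  obtain ⟨e, he⟩ := h.exists_equiv hcard
  have hvertex (v : V) : cl v = (e.symm (.inl v)).2 ∧ ok v (e.symm (.inl v)).1 := by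
    simpa [CanPlace] using he (e.symm (.inl v))
  have hidle (i : Σ c, Fin (idle c)) : i.1 = (e.symm (.inr i)).1 := by
    simpa [CanPlace] using he (e.symm (.inr i))
  refine ⟨fun v => (e.symm (.inl v)).1, ⟨fun v => (hvertex v).2, fun u v huv hφ => ?_⟩,
    fun c => ?_⟩
  · rw [(hvertex u).1, (hvertex v).1] at huv
    exact Sum.inl.inj (e.symm.injective (Prod.ext hφ huv))
  · let colors : {v | (e.symm (.inl v)).1 = c} ⊕ Fin (idle c) ≃ ι :=
      calc {v | (e.symm (.inl v)).1 = c} ⊕ Fin (idle c)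
        _ ≃ {v // (e.symm (.inl v)).1 = c} ⊕ {i // (e.symm (.inr i)).1 = c} :=
          .sumCongr (.refl _) ((Equiv.sigmaSubtype c).symm.trans
            (.subtypeEquivRight fun i => by rw [hidle i]))
        _ ≃ {z // (e.symm z).1 = c} := (Equiv.subtypeSum (p := fun z => (e.symm z).1 = c)).symm
        _ ≃ {x : κ × ι // x.1 = c} := e.symm.subtypeEquiv fun _ => Iff.rfl
        _ ≃ {d // d = c} × ι := Equiv.prodSubtypeFstEquivSubtypeProd (p := (· = c))
        _ ≃ ι := .uniqueProd ι _
    rw [← Nat.card_eq_fintype_card, ← Nat.card_congr colors, Nat.card_sum, Nat.card_fin,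
      Nat.card_coe_set_eq]

end Sufficiency

end Hall

section Compression

variable {V ι κ : Type*} [Fintype V] [Fintype κ] {𝓒 : Finset (Finset κ)} {cl : V → ι}
  {ok : V → κ → Prop} {idle : κ → ℕ}

theorem deficiency_le_deficiency_univ (S : Finset κ) (a : ι) :
    deficiency 𝓒 cl ok S a ≤ deficiency univ cl ok S a :=
  deficiency_le_iff.2 fun T _ hTS => card_le_candidates_add_deficiency (mem_univ T) hTS a

theorem deficiency_univ_le_of_monotone {f : Finset κ → Finset κ} (hf : Monotone f)
    (hmem : ∀ T, f T ∈ 𝓒) (hcard : ∀ T, #(f T) = #T)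
    (hcand : ∀ a T, candidates cl ok a (f T) = candidates cl ok a T) (S : Finset κ) (a : ι) :
    deficiency univ cl ok S a ≤ deficiency 𝓒 cl ok (f S) a := by
  refine deficiency_le_iff.2 fun T _ hTS => ?_
  rw [← hcard T, ← hcand a T]
  exact card_le_candidates_add_deficiency (hmem T) (hf hTS) a

theorem hallCondition_univ_iff_of_monotone [Fintype ι] {f : Finset κ → Finset κ}
    (hf : Monotone f) (hmem : ∀ T, f T ∈ 𝓒) (hcard : ∀ T, #(f T) = #T)
    (hcand : ∀ a T, candidates cl ok a (f T) = candidates cl ok a T)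
    (hidle : ∀ S, ∑ c ∈ f S, idle c = ∑ c ∈ S, idle c) :
    HallCondition univ cl ok idle ↔ HallCondition 𝓒 cl ok idle := by
  refine ⟨fun h S _ => ?_, fun h S _ => ?_⟩
  · exact (sum_le_sum fun a _ => deficiency_le_deficiency_univ S a).trans (h S (mem_univ S))
  · rw [← hidle]
    exact (sum_le_sum fun a _ => deficiency_univ_le_of_monotone hf hmem hcard hcand S a).trans
      (h (f S) (hmem S))

end Compression

section Codes

variable {k : ℕ}

/-- The set of colors with code `(s, j)`: those of the first `r` colors that are given by the
binary digits of `s`, and the next `j` colors. -/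
def codeSet (k r s j : ℕ) : Finset (Fin k) :=
  {c | if (c : ℕ) < r then s.testBit c else (c : ℕ) < r + j}

/-- Replace the colors from `r` on by an initial segment of these colors. -/
def compress (r : ℕ) (T : Finset (Fin k)) : Finset (Fin k) :=
  {c | if (c : ℕ) < r then c ∈ T else (c : ℕ) < r + #{d ∈ T | ¬ d.val < r}}

/-- The sets of colors with a code. -/
def codeSets (k r : ℕ) : Finset (Finset (Fin k)) :=
  (range (2 ^ r) ×ˢ range (k + 1)).image fun x => codeSet k r x.1 x.2

theorem mem_codeSet {r s j : ℕ} {c : Fin k} :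
    c ∈ codeSet k r s j ↔ if (c : ℕ) < r then s.testBit c = true else (c : ℕ) < r + j := by
  simp [codeSet]

theorem mem_compress {r : ℕ} {T : Finset (Fin k)} {c : Fin k} :
    c ∈ compress r T ↔
      if (c : ℕ) < r then c ∈ T else (c : ℕ) < r + #{d ∈ T | ¬ d.val < r} := by
  simp [compress]

theorem testBit_sum_two_pow (A : Finset ℕ) (i : ℕ) :
    (∑ v ∈ A, 2 ^ v).testBit i = true ↔ i ∈ A := by
  conv_rhs => rw [← toFinset_bitIndices_sum_two_pow A]
  rw [List.mem_toFinset, Nat.mem_bitIndices]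

theorem compress_mem_codeSets (r : ℕ) (T : Finset (Fin k)) : compress r T ∈ codeSets k r := by
  let low : Finset ℕ := {c ∈ T.map Fin.valEmbedding | c < r}
  have hlow : ∑ c ∈ low, 2 ^ c < 2 ^ r :=
    Nat.geomSum_lt le_rfl fun c hc => (mem_filter.1 hc).2
  have hcard : #{d ∈ T | ¬ d.val < r} < k + 1 :=
    Nat.lt_succ_of_le (card_finset_fin_le _)
  refine mem_image.2 ⟨(∑ c ∈ low, 2 ^ c, #{d ∈ T | ¬ d.val < r}),
    mem_product.2 ⟨mem_range.2 hlow, mem_range.2 hcard⟩, ?_⟩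
  ext c
  have hc : (c : ℕ) ∈ low ↔ c ∈ T ∧ (c : ℕ) < r := by simp [low, Fin.val_inj]
  rw [mem_codeSet, mem_compress, testBit_sum_two_pow, hc]
  split_ifs with hcr <;> simp [hcr]

theorem compress_mono (r : ℕ) : Monotone (compress r : Finset (Fin k) → Finset (Fin k)) := by
  intro T S hTS c
  have := card_le_card (filter_subset_filter (fun d : Fin k => ¬ d.val < r) hTS)
  by_cases hc : (c : ℕ) < r
  · simpa [compress, hc] using fun h => hTS h
  · simp only [compress, hc, mem_filter, mem_univ, true_and, if_false]
    lia

theorem filter_compress_lt (r : ℕ) (T : Finset (Fin k)) :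
    {c ∈ compress r T | c.val < r} = {c ∈ T | c.val < r} := by
  ext c
  by_cases hc : (c : ℕ) < r <;> simp [compress, hc]

theorem card_filter_compress_not_lt (r : ℕ) (T : Finset (Fin k)) :
    #{c ∈ compress r T | ¬ c.val < r} = #{c ∈ T | ¬ c.val < r} := by
  have hle : #{c ∈ T | ¬ c.val < r} ≤ k - r := by
    rw [← Nat.card_Ico, ← card_map Fin.valEmbedding]
    exact card_le_card fun c => by simp; lia
  have hIco : {c ∈ compress r T | ¬ c.val < r}.map Fin.valEmbedding =
      Ico r (r + #{c ∈ T | ¬ c.val < r}) := by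
    ext c
    simp only [mem_map, mem_filter, Fin.valEmbedding_apply, mem_Ico, compress, mem_univ, true_and]
    constructor
    · rintro ⟨d, hd, rfl⟩
      grind
    · intro hc
      exact ⟨⟨c, by lia⟩, by grind⟩
  rw [← card_map Fin.valEmbedding, hIco, Nat.card_Ico, Nat.add_sub_cancel_left]

theorem card_compress (r : ℕ) (T : Finset (Fin k)) : #(compress r T) = #T := by
  rw [← card_filter_add_card_filter_not (s := T) fun c => (c : ℕ) < r,
    ← card_filter_add_card_filter_not (s := compress r T) fun c => (c : ℕ) < r,
    filter_compress_lt, card_filter_compress_not_lt]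

theorem sum_compress {r i : ℕ} {idle : Fin k → ℕ} (hidle : ∀ c : Fin k, r ≤ c → idle c = i)
    (T : Finset (Fin k)) : ∑ c ∈ compress r T, idle c = ∑ c ∈ T, idle c := by
  have hhigh (A : Finset (Fin k)) : ∑ c ∈ A with ¬ c.val < r, idle c =
      #{c ∈ A | ¬ c.val < r} * i :=
    sum_const_nat fun c hc => hidle c (by simpa using (mem_filter.1 hc).2)
  rw [← sum_filter_add_sum_filter_not T fun c => (c : ℕ) < r,
    ← sum_filter_add_sum_filter_not (compress r T) fun c => (c : ℕ) < r, filter_compress_lt,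
    hhigh, hhigh, card_filter_compress_not_lt]

variable {V ι : Type*} [Fintype V] {cl : V → ι} {ok : V → Fin k → Prop}

theorem candidates_compress {r : ℕ} (hok : ∀ v, ∀ c : Fin k, r ≤ c → ok v c) (a : ι)
    (T : Finset (Fin k)) : candidates cl ok a (compress r T) = candidates cl ok a T := by
  have hlow (c : Fin k) (hc : c.val < r) : c ∈ compress r T ↔ c ∈ T := by simp [compress, hc]
  have hhigh : (∃ c ∈ compress r T, ¬ c.val < r) ↔ ∃ c ∈ T, ¬ (c : ℕ) < r := by
    simpa [Finset.Nonempty] using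
      iff_of_eq (congrArg (0 < ·) (card_filter_compress_not_lt r T))
  ext v
  simp only [mem_candidates]
  refine and_congr_right fun _ => ⟨?_, ?_⟩ <;> rintro ⟨c, hc, hvc⟩ <;> by_cases hcr : (c : ℕ) < r
  · exact ⟨c, (hlow c hcr).1 hc, hvc⟩
  · obtain ⟨d, hd, hdr⟩ := hhigh.1 ⟨c, hc, hcr⟩
    exact ⟨d, hd, hok v d (not_lt.1 hdr)⟩
  · exact ⟨c, (hlow c hcr).2 hc, hvc⟩
  · obtain ⟨d, hd, hdr⟩ := hhigh.2 ⟨c, hc, hcr⟩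
    exact ⟨d, hd, hok v d (not_lt.1 hdr)⟩

theorem hallCondition_univ_iff_codeSets [Fintype ι] {r i : ℕ} {idle : Fin k → ℕ}
    (hok : ∀ v, ∀ c : Fin k, r ≤ c → ok v c) (hidle : ∀ c : Fin k, r ≤ c → idle c = i) :
    HallCondition univ cl ok idle ↔ HallCondition (codeSets k r) cl ok idle :=
  hallCondition_univ_iff_of_monotone (compress_mono r) (compress_mem_codeSets r) (card_compress r)
    (candidates_compress hok) (sum_compress hidle)

end Codes

section Cluster

variable {V : Type*} {G : SimpleGraph V}

theorem isCluster_iff_adj_trans :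
    G.IsCluster ↔ ∀ a b c, G.Adj a b → G.Adj b c → a ≠ c → G.Adj a c := by
  refine ⟨fun h a b c hab hbc hac => ?_, fun h C u hu v hv huv => ?_⟩
  · exact h (G.connectedComponentMk a) rfl
      (SimpleGraph.ConnectedComponent.sound (hab.reachable.trans hbc.reachable).symm) hac
  · obtain ⟨p⟩ := SimpleGraph.ConnectedComponent.exact (hu.trans hv.symm)
    clear hu hv
    induction p with
    | nil => exact absurd rfl huv
    | @cons a b c hab _ ih =>
      by_cases hbc : b = c
      · exact hbc ▸ hab
      · exact h a b c hab (ih hbc) huv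

theorem connectedComponentMk_eq_iff_of_isCluster (h : G.IsCluster) {u v : V} :
    G.connectedComponentMk u = G.connectedComponentMk v ↔ u = v ∨ G.Adj u v := by
  refine ⟨fun huv => or_iff_not_imp_left.2 fun hne => h _ huv rfl hne, ?_⟩
  rintro (rfl | huv)
  · rfl
  · exact SimpleGraph.ConnectedComponent.sound huv.reachable

end Cluster

section Extension

variable {V κ : Type*} {G : SimpleGraph V} {M : Set V} (χ : (G.induce M).Coloring κ)

/-- The color `c` does not occur among the neighbors of `v` in the precolored set. -/
def IsFree (v : (Mᶜ : Set V)) (c : κ) : Prop :=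
  ∀ u : M, χ u = c → ¬ G.Adj u v

/-- The greatest size that the class of the color `c` can have in an extension of `χ` when the
uncolored part is a cluster graph: each clique contributes at most one vertex. -/
noncomputable def supply (c : κ) : ℕ :=
  Nat.card (G.induce Mᶜ).ConnectedComponent + {u : M | χ u = c}.ncard

variable {χ}

theorem ncard_color_eq_add [Finite V] {ψ : V → κ} (c : κ) :
    {v | ψ v = c}.ncard = {v : (Mᶜ : Set V) | ψ v = c}.ncard + {u : M | ψ u = c}.ncard := by
  have hsub (A : Set V) : {u : A | ψ u = c}.ncard = (A ∩ {v | ψ v = c}).ncard := by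
    rw [← Set.ncard_image_of_injective _ Subtype.val_injective]
    exact congrArg Set.ncard (Subtype.image_preimage_val A {v | ψ v = c})
  rw [hsub, hsub, add_comm, ← Set.ncard_inter_add_ncard_sdiff_eq_ncard _ M, Set.inter_comm,
    Set.sdiff_eq, Set.inter_comm {v | ψ v = c}]

theorem exists_extension_iff_exists_coloring_compl (hM : (G.induce Mᶜ).IsCluster)
    (P : (V → κ) → Prop) :
    (∃ ψ : G.Coloring κ, (∀ u : M, ψ u = χ u) ∧ P ψ) ↔
      ∃ ψ : V → κ, (∀ u : M, ψ u = χ u) ∧ P ψ ∧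
        IsProper (G.induce Mᶜ).connectedComponentMk (IsFree χ) fun v => ψ v := by
  constructor
  · rintro ⟨ψ, hχ, hP⟩
    refine ⟨ψ, hχ, hP, fun v u hu huv => ψ.valid huv ((hχ u).trans hu), fun u v huv hψ => ?_⟩
    exact ((connectedComponentMk_eq_iff_of_isCluster hM).1 huv).resolve_right
      fun hadj => ψ.valid hadj hψ
  · rintro ⟨ψ, hχ, hP, hproper⟩
    refine ⟨.mk ψ fun {u v} huv hψ => ?_, hχ, hP⟩
    by_cases hu : u ∈ M <;> by_cases hv : v ∈ M
    · exact χ.valid (v := ⟨u, hu⟩) (w := ⟨v, hv⟩) huv (by rw [← hχ, ← hχ, hψ])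
    · exact hproper.ok ⟨v, hv⟩ ⟨u, hu⟩ (by rw [← hχ, hψ]) huv
    · exact hproper.ok ⟨u, hu⟩ ⟨v, hv⟩ (by rw [← hχ, hψ]) huv.symm
    · refine huv.ne (congrArg Subtype.val (hproper.inj ⟨u, hu⟩ ⟨v, hv⟩ ?_ hψ))
      exact (connectedComponentMk_eq_iff_of_isCluster hM).2 (.inr huv)

theorem exists_coloring_compl_iff [Finite V] {m : ℕ} :
    (∃ ψ : V → κ, (∀ u : M, ψ u = χ u) ∧ (∀ c, {v | ψ v = c}.ncard = m) ∧
        IsProper (G.induce Mᶜ).connectedComponentMk (IsFree χ) fun v => ψ v) ↔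
      ∃ φ : (Mᶜ : Set V) → κ, (∀ c, {v | φ v = c}.ncard + {u : M | χ u = c}.ncard = m) ∧
        IsProper (G.induce Mᶜ).connectedComponentMk (IsFree χ) φ := by
  classical
  constructor
  · rintro ⟨ψ, hχ, hm, h⟩
    exact ⟨fun v => ψ v, fun c => by rw [← hm c, ncard_color_eq_add (M := M)]; simp only [hχ], h⟩
  · rintro ⟨φ, hm, h⟩
    let ψ : V → κ := fun v => if hv : v ∈ M then χ ⟨v, hv⟩ else φ ⟨v, hv⟩
    have hχ (u : M) : ψ u = χ u := dif_pos u.2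
    have hφ (v : (Mᶜ : Set V)) : ψ v = φ v := dif_neg v.2
    refine ⟨ψ, hχ, fun c => ?_, ?_⟩
    · rw [← hm c, ncard_color_eq_add (M := M)]
      simp only [hχ, hφ]
    · simpa only [hφ] using h

theorem IsProper.le_supply [Finite V] {φ : (Mᶜ : Set V) → κ} {c : κ} {m : ℕ}
    (hφ : IsProper (G.induce Mᶜ).connectedComponentMk (IsFree χ) φ)
    (hcard : {v | φ v = c}.ncard + {u : M | χ u = c}.ncard = m) : m ≤ supply χ c := by
  have hinj : Set.InjOn (G.induce Mᶜ).connectedComponentMk {v | φ v = c} :=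
    fun u hu v hv huv => hφ.inj u v huv (Eq.trans hu (Eq.symm hv))
  rw [← hcard, supply, ← hinj.ncard_image, ← Set.ncard_univ]
  exact Nat.add_le_add_right (Set.ncard_le_ncard (Set.subset_univ _)) _

section Exact

variable [Fintype (G.induce Mᶜ).ConnectedComponent] {m : ℕ}

theorem isColoring_supply_sub_iff (hm : ∀ c, m ≤ supply χ c) {φ : (Mᶜ : Set V) → κ} :
    IsColoring (G.induce Mᶜ).connectedComponentMk (IsFree χ) (fun c => supply χ c - m) φ ↔
      (∀ c, {v | φ v = c}.ncard + {u : M | χ u = c}.ncard = m) ∧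
        IsProper (G.induce Mᶜ).connectedComponentMk (IsFree χ) φ := by
  have hsize (c : κ) : {v | φ v = c}.ncard + (supply χ c - m) =
      Fintype.card (G.induce Mᶜ).ConnectedComponent ↔
        {v | φ v = c}.ncard + {u : M | χ u = c}.ncard = m := by
    have := hm c
    rw [supply, Nat.card_eq_fintype_card] at *
    lia
  exact ⟨fun h => ⟨fun c => (hsize c).1 (h.ncard_add_idle c), h.toIsProper⟩,
    fun ⟨hcard, hφ⟩ => ⟨hφ, fun c => (hsize c).2 (hcard c)⟩⟩

theorem card_compl_add_sum_supply_sub [Fintype V] [Fintype κ] [Fintype (Mᶜ : Set V)]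
    (hcard : Fintype.card V = Fintype.card κ * m) (hm : ∀ c, m ≤ supply χ c) :
    Fintype.card (Mᶜ : Set V) + ∑ c, (supply χ c - m) =
      Fintype.card κ * Fintype.card (G.induce Mᶜ).ConnectedComponent := by
  have hM : ∑ c, {u : M | χ u = c}.ncard = Nat.card M := by
    rw [← Nat.card_congr (Equiv.sigmaFiberEquiv χ), Nat.card_sigma]
    rfl
  have hsum : ∑ c, (supply χ c - m) + Fintype.card κ * m =
      Fintype.card κ * Fintype.card (G.induce Mᶜ).ConnectedComponent + Nat.card M := by
    calc ∑ c, (supply χ c - m) + Fintype.card κ * m = ∑ c, (supply χ c - m + m) := by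
          simp [sum_add_distrib]
      _ = ∑ c, supply χ c := sum_congr rfl fun c _ => Nat.sub_add_cancel (hm c)
      _ = _ := by simp [supply, sum_add_distrib, hM]
  have hcompl : Nat.card M + Nat.card (Mᶜ : Set V) = Nat.card V := Set.ncard_add_ncard_compl M
  simp only [Nat.card_eq_fintype_card] at *
  lia

theorem exists_exact_extension_iff [Fintype V] [Fintype κ] [Fintype (Mᶜ : Set V)]
    (hM : (G.induce Mᶜ).IsCluster) (hcard : Fintype.card V = Fintype.card κ * m) :
    (∃ ψ : G.Coloring κ, (∀ u : M, ψ u = χ u) ∧ ∀ c, {v | ψ v = c}.ncard = m) ↔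
      (∀ c, m ≤ supply χ c) ∧
        HallCondition univ (G.induce Mᶜ).connectedComponentMk (IsFree χ)
          fun c => supply χ c - m := by
  rw [exists_extension_iff_exists_coloring_compl hM fun ψ => ∀ c, {v | ψ v = c}.ncard = m,
    exists_coloring_compl_iff]
  constructor
  · rintro ⟨φ, hφ⟩
    have hm (c : κ) : m ≤ supply χ c := hφ.2.le_supply (hφ.1 c)
    exact ⟨hm, ((isColoring_supply_sub_iff hm).2 hφ).hallCondition⟩
  · rintro ⟨hm, hall⟩
    obtain ⟨φ, hφ⟩ := hall.exists_isColoring (card_compl_add_sum_supply_sub hcard hm)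
    exact ⟨φ, (isColoring_supply_sub_iff hm).1 hφ⟩

end Exact

end Extension

section Representatives

variable {V : Type*} [Fintype V] [LinearOrder V] {G : SimpleGraph V}
  [Fintype G.ConnectedComponent]

open Classical in
theorem sum_connectedComponent_of_isCluster (hG : G.IsCluster) {A : Type*} [AddCommMonoid A]
    (f : G.ConnectedComponent → A) :
    ∑ C, f C = ∑ v with ∀ u < v, ¬ G.Adj u v, f (G.connectedComponentMk v) := by
  symm
  refine sum_bij (fun v _ => G.connectedComponentMk v) (fun _ _ => mem_univ _)
    (fun u hu v hv huv => ?_) (fun C _ => ?_) (fun _ _ => rfl)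
  · refine ((connectedComponentMk_eq_iff_of_isCluster hG).1 huv).elim id fun hadj => ?_
    rcases hadj.ne.lt_or_gt with hlt | hlt
    · exact absurd hadj ((mem_filter.1 hv).2 u hlt)
    · exact absurd hadj.symm ((mem_filter.1 hu).2 v hlt)
  · obtain ⟨v, hv, hmin⟩ := exists_min_image (univ.filter fun v => G.connectedComponentMk v = C)
      id (C.ind fun v => ⟨v, by simp⟩)
    have hvC : G.connectedComponentMk v = C := (mem_filter.1 hv).2
    refine ⟨v, mem_filter.2 ⟨mem_univ v, fun u hlt hadj => ?_⟩, hvC⟩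
    refine (hmin u (mem_filter.2 ⟨mem_univ u, ?_⟩)).not_gt hlt
    exact hvC ▸ SimpleGraph.ConnectedComponent.sound hadj.reachable

end Representatives

section Padding

variable {V W κ : Type*} {G : SimpleGraph V} {m : ℕ}

theorem ncard_color_sum_eq_add [Finite V] [Finite W] {ψ : V ⊕ W → κ} (c : κ) :
    {v | ψ v = c}.ncard = {v | ψ (.inl v) = c}.ncard + {w | ψ (.inr w) = c}.ncard := by
  rw [← Set.ncard_image_of_injective {v | ψ (.inl v) = c} (Sum.inl_injective (β := W)),
    ← Set.ncard_image_of_injective {w | ψ (.inr w) = c} (Sum.inr_injective (α := V)),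
    ← Set.ncard_union_eq Set.disjoint_image_inl_image_inr]
  congr 1
  ext (v | w) <;> simp

theorem ncard_color_inr_le [Fintype W] (ψ : (G ⊕g (⊤ : SimpleGraph W)).Coloring κ) (c : κ) :
    {w | ψ (.inr w) = c}.ncard ≤ min 1 (Fintype.card W) := by
  refine le_min ((Set.ncard_le_one (Set.toFinite _)).2 fun u hu w hw => ?_) ?_
  · by_contra hne
    exact ψ.valid (show (G ⊕g (⊤ : SimpleGraph W)).Adj (.inr u) (.inr w) from hne)
      (Eq.trans hu (Eq.symm hw))
  · exact (Set.ncard_le_ncard (Set.subset_univ _)).trans (by simp [Set.ncard_univ])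

variable [Fintype V] [Fintype W] [Fintype κ]

theorem card_filter_ncard_color_lt
    (hcard : Fintype.card V + Fintype.card W = Fintype.card κ * m) {φ : V → κ}
    (hφ : ∀ c, {v | φ v = c}.ncard ≤ m ∧ m ≤ {v | φ v = c}.ncard + 1) :
    #{c | {v | φ v = c}.ncard < m} = Fintype.card W := by
  have hV : ∑ c, {v | φ v = c}.ncard = Fintype.card V := by
    rw [← Nat.card_eq_fintype_card, ← Nat.card_congr (Equiv.sigmaFiberEquiv φ), Nat.card_sigma]
    rfl
  have hsum : ∑ c, ({v | φ v = c}.ncard + if {v | φ v = c}.ncard < m then 1 else 0) =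
      ∑ _c : κ, m := by
    refine sum_congr rfl fun c _ => ?_
    have := hφ c
    split_ifs <;> lia
  rw [sum_add_distrib, hV, ← card_filter, sum_const, card_univ, smul_eq_mul] at hsum
  lia

theorem exists_exact_coloring_sum_top
    (hcard : Fintype.card V + Fintype.card W = Fintype.card κ * m) (φ : G.Coloring κ)
    (hφ : ∀ c, {v | φ v = c}.ncard ≤ m ∧ m ≤ {v | φ v = c}.ncard + 1) :
    ∃ ψ : (G ⊕g (⊤ : SimpleGraph W)).Coloring κ, ∀ c, {v | ψ v = c}.ncard = m := by
  classical
  let e : W ≃ {c // c ∈ univ.filter fun c => {v | φ v = c}.ncard < m} :=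
    Fintype.equivOfCardEq (by rw [Fintype.card_coe, card_filter_ncard_color_lt hcard hφ])
  have hfiber (c : κ) : {w | (e w : κ) = c}.ncard = if {v | φ v = c}.ncard < m then 1 else 0 := by
    split_ifs with hc
    · rw [Set.ncard_eq_one]
      refine ⟨e.symm ⟨c, mem_filter.2 ⟨mem_univ c, hc⟩⟩, Set.ext fun w => ?_⟩
      simp [Equiv.eq_symm_apply, Subtype.ext_iff]
    · rw [Set.ncard_eq_zero]
      exact Set.eq_empty_of_forall_notMem fun w hw => hc (hw ▸ (mem_filter.1 (e w).2).2)
  refine ⟨.mk (Sum.elim φ fun w => e w) fun {u v} huv => ?_, fun c => ?_⟩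
  · rcases u with u | u <;> rcases v with v | v <;> simp_all [φ.valid]
  · rw [ncard_color_sum_eq_add]
    have := hφ c
    have := hfiber c
    simp only [SimpleGraph.Coloring.mk, RelHom.coeFn_mk, Sum.elim_inl, Sum.elim_inr]
    split_ifs at this <;> lia

theorem equitablyColorable_iff_exists_exact_coloring {k : ℕ} (hk : 0 < k)
    (hcard : Fintype.card V + Fintype.card W = k * (Fintype.card V ⌈/⌉ k)) :
    G.EquitablyColorable k ↔ ∃ ψ : (G ⊕g (⊤ : SimpleGraph W)).Coloring (Fin k),
      ∀ c, {v | ψ v = c}.ncard = Fintype.card V ⌈/⌉ k := by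
  have hceil : Fintype.card V ⌈/⌉ k ≤ Fintype.card V / k + 1 :=
    (ceilDiv_le_iff_le_mul hk).2 (Nat.lt_mul_div_succ _ hk).le
  constructor
  · rintro ⟨φ, hφ⟩
    refine exists_exact_coloring_sum_top (by simpa using hcard) φ fun c => ?_
    have := hφ c
    lia
  · rintro ⟨ψ, hψ⟩
    refine ⟨ψ.sumLeft, fun c => ?_⟩
    have hinr := ncard_color_inr_le ψ c
    have hadd := hψ c
    rw [ncard_color_sum_eq_add] at hadd
    change _ ≤ {v | ψ (.inl v) = c}.ncard ∧ {v | ψ (.inl v) = c}.ncard ≤ _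
    rcases Nat.eq_zero_or_pos (Fintype.card W) with hW | hW
    · have : Fintype.card V / k = Fintype.card V ⌈/⌉ k :=
        Nat.div_eq_of_eq_mul_right hk (by lia)
      lia
    · have : Fintype.card V / k < Fintype.card V ⌈/⌉ k :=
        Nat.div_lt_of_lt_mul (by lia)
      lia

end Padding

section Symmetry

variable {V : Type*} {G : SimpleGraph V} {M : Set V} {k r m : ℕ}

theorem exists_perm_forall_lt {I : Finset (Fin k)} (hI : #I ≤ r) :
    ∃ σ : Equiv.Perm (Fin k), ∀ c ∈ I, (σ c : ℕ) < r := by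
  have hIk : #I ≤ k := by simpa using I.card_le_univ
  let e : {c // c ∈ I} ≃ {c : Fin k // c ∈ univ.map (Fin.castLEEmb hIk)} :=
    Fintype.equivOfCardEq (by rw [Fintype.card_coe, Fintype.card_coe, card_map, card_fin])
  refine ⟨e.extendSubtype, fun c hc => ?_⟩
  obtain ⟨i, -, hi⟩ := mem_map.1 (e.extendSubtype_mem c hc)
  rw [← hi]
  exact i.2.trans_le hI

theorem exists_exact_coloring_iff_exists_lt [Finite V] (hM : M.ncard ≤ r) :
    (∃ ψ : G.Coloring (Fin k), ∀ c, {v | ψ v = c}.ncard = m) ↔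
      ∃ χ : (G.induce M).Coloring (Fin k), (∀ u, (χ u : ℕ) < r) ∧
        ∃ ψ : G.Coloring (Fin k), (∀ u : M, ψ u = χ u) ∧ ∀ c, {v | ψ v = c}.ncard = m := by
  classical
  refine ⟨fun ⟨ψ, hψ⟩ => ?_, fun ⟨_, _, ψ, _, hψ⟩ => ⟨ψ, hψ⟩⟩
  obtain ⟨σ, hσ⟩ := exists_perm_forall_lt (r := r) (I := (ψ '' M).toFinset)
    (by rw [← Set.ncard_eq_toFinset_card']; exact (Set.ncard_image_le M.toFinite).trans hM)
  have hvalid : ∀ {u v}, G.Adj u v → σ (ψ u) ≠ σ (ψ v) :=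
    fun huv => σ.injective.ne (ψ.valid huv)
  refine ⟨.mk (fun u => σ (ψ u)) hvalid, fun u => hσ _ (by simpa using ⟨u, u.2, rfl⟩),
    .mk (fun v => σ (ψ v)) hvalid, fun _ => rfl, fun c => ?_⟩
  rw [← hψ (σ.symm c)]
  exact congrArg Set.ncard (Set.ext fun v => σ.eq_symm_apply.symm)

end Symmetry

section Equitable

theorem exists_coloring_forall_ncard_congr {V W κ : Type*} {G : SimpleGraph V} {H : SimpleGraph W}
    (e : G ≃g H) (P : ℕ → Prop) :
    (∃ ψ : G.Coloring κ, ∀ c, P {v | ψ v = c}.ncard) ↔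
      ∃ ψ : H.Coloring κ, ∀ c, P {v | ψ v = c}.ncard := by
  refine ⟨fun ⟨ψ, hψ⟩ => ⟨ψ.comp e.symm.toHom, fun c => ?_⟩,
    fun ⟨ψ, hψ⟩ => ⟨ψ.comp e.toHom, fun c => ?_⟩⟩
  · convert hψ c using 1
    exact Set.ncard_preimage_of_injective_subset_range (s := {v | ψ v = c}) e.symm.injective
      fun v _ => e.symm.surjective v
  · convert hψ c using 1
    exact Set.ncard_preimage_of_injective_subset_range (s := {v | ψ v = c}) e.injective
      fun v _ => e.surjective v

theorem equitablyColorable_of_card_le {V : Type*} [Fintype V] {G : SimpleGraph V} {k : ℕ}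
    (h : Fintype.card V ≤ k) : G.EquitablyColorable k := by
  obtain ⟨f⟩ : Nonempty (V ↪ Fin k) := Function.Embedding.nonempty_of_card_le (by simpa using h)
  refine ⟨.mk f fun huv => f.injective.ne huv.ne, fun c => ⟨?_, ?_⟩⟩
  · rcases h.lt_or_eq with hlt | heq
    · exact (Nat.div_eq_of_lt hlt).trans_le (Nat.zero_le _)
    · have hbij := (Fintype.bijective_iff_injective_and_card f).2 ⟨f.injective, by simpa using heq⟩
      rw [heq, Nat.div_self c.pos]
      exact (Set.ncard_pos).2 (hbij.2 c)
  · rcases Set.eq_empty_or_nonempty {v | f v = c} with hempty | ⟨v, -⟩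
    · exact (congrArg Set.ncard hempty).trans_le (by simp)
    · refine ((Set.ncard_le_one (Set.toFinite _)).2
        fun a ha b hb => f.injective (Eq.trans ha hb.symm)).trans ?_
      rw [Nat.one_le_iff_ne_zero, ← Nat.pos_iff_ne_zero, ← not_le, ceilDiv_le_iff_le_mul c.pos,
        mul_zero, not_le]
      exact Fintype.card_pos_iff.2 ⟨v⟩

end Equitable

end CliqueColoring

/-! ### Functions computed in polynomial time -/

namespace RAM

open Finset

/-- `T` is bounded by a polynomial in the resource `B`. -/
def PolyBounded (B T : List Bool → ℕ) : Prop :=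
  ∃ C D : ℕ, ∀ w, T w ≤ C * (B w + 1) ^ D

namespace PolyBounded

variable {B T T' : List Bool → ℕ}

theorem const (c : ℕ) : PolyBounded B fun _ => c := ⟨c, 0, fun w => by simp⟩

theorem self : PolyBounded B B := ⟨1, 1, fun w => by simp⟩

theorem add (h : PolyBounded B T) (h' : PolyBounded B T') :
    PolyBounded B fun w => T w + T' w := by
  obtain ⟨C, D, hC⟩ := h
  obtain ⟨C', D', hC'⟩ := h'
  refine ⟨C + C', max D D', fun w => ?_⟩
  calc T w + T' w ≤ C * (B w + 1) ^ D + C' * (B w + 1) ^ D' := add_le_add (hC w) (hC' w)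
    _ ≤ C * (B w + 1) ^ max D D' + C' * (B w + 1) ^ max D D' := by
      gcongr <;> simp
    _ = _ := by ring

theorem mul (h : PolyBounded B T) (h' : PolyBounded B T') :
    PolyBounded B fun w => T w * T' w := by
  obtain ⟨C, D, hC⟩ := h
  obtain ⟨C', D', hC'⟩ := h'
  refine ⟨C * C', D + D', fun w => ?_⟩
  calc T w * T' w ≤ C * (B w + 1) ^ D * (C' * (B w + 1) ^ D') := Nat.mul_le_mul (hC w) (hC' w)
    _ = _ := by ring

end PolyBounded

/-- The data a subprogram works on: an input word together with the values of `size` many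
numerical variables. A bound variable is added by passing from `α` to `α × ℕ`. -/
class Context (α : Type) where
  word : α → List Bool
  size : ℕ
  var : α → ℕ → ℕ

instance : Context (List Bool) where
  word w := w
  size := 0
  var _ _ := 0

instance {α : Type} [Context α] : Context (α × ℕ) where
  word p := Context.word p.1
  size := Context.size α + 1
  var p j := if j = Context.size α then p.2 else Context.var p.1 j

/-- The memory contains the input word in its lowest registers, as in `initMem`. -/
structure Loads (m : Mem) (w : List Bool) : Prop where
  length : m 0 = w.length
  letter : ∀ i < w.length, m (i + 1) = (w.getD i false).toNat

/-- The memory contains the input word and, behind it, the variables of the context, the `j`-th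
one in slot `pos j`. Slot `s` is the register `s + 1` places behind the end of the word. -/
def Holds {α : Type} [Context α] (m : Mem) (pos : ℕ → ℕ) (a : α) : Prop :=
  Loads m (Context.word a) ∧
    ∀ j < Context.size α, m ((Context.word a).length + (pos j + 1)) = Context.var a j

/-- The address of a slot behind the input word. -/
def slot (s : ℕ) : Expr := .add (.read (.const 0)) (.const (s + 1))

/-- The contents of a slot. -/
def get (s : ℕ) : Expr := .read (slot s)

/-- Assignment to a slot. -/
def put (s : ℕ) (e : Expr) : Prog := .store (slot s) e

/-- Started on `m`, the program halts within `T` steps with the value `v` in slot `s` and without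
changing anything below this slot. -/
def Yields (p : Prog) (m : Mem) (w : List Bool) (s v T : ℕ) : Prop :=
  ∃ t m', t ≤ T ∧ Runs p m t m' ∧ m' (w.length + (s + 1)) = v ∧
    ∀ i < w.length + (s + 1), m' i = m i

theorem cost_get (s : ℕ) : (get s).cost = 5 := rfl

theorem loads_initMem (w : List Bool) : Loads (initMem w) w := ⟨rfl, fun _ _ => rfl⟩

section Slots

variable {m m' : Mem} {w : List Bool} {s : ℕ}

theorem Loads.congr (h : Loads m w) (h' : ∀ i < w.length + (s + 1), m' i = m i) : Loads m' w :=
  ⟨by rw [h' 0 (by omega), h.length], fun i hi => by rw [h' (i + 1) (by omega), h.letter i hi]⟩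

theorem Holds.congr {α : Type} [Context α] {pos : ℕ → ℕ} {a : α} (h : Holds m pos a)
    (hs : ∀ j < Context.size α, pos j < s)
    (h' : ∀ i < (Context.word a).length + (s + 1), m' i = m i) : Holds m' pos a :=
  ⟨h.1.congr h', fun j hj => by rw [h' _ (by have := hs j hj; omega), h.2 j hj]⟩

theorem Holds.push {α : Type} [Context α] {pos : ℕ → ℕ} {a : α} {v : ℕ} (h : Holds m pos a)
    (hv : m ((Context.word a).length + (s + 1)) = v) :
    Holds m (Function.update pos (Context.size α) s) (a, v) := by
  refine ⟨h.1, fun j hj => ?_⟩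
  rcases (Nat.lt_succ_iff_lt_or_eq.1 hj : j < Context.size α ∨ j = Context.size α) with hj | rfl
  · simpa [Context.var, Context.word, hj.ne] using h.2 j hj
  · simpa [Context.var, Context.word] using hv

theorem update_lt {pos : ℕ → ℕ} {k v s' : ℕ} (h : ∀ j < k, pos j < s) (hv : v < s')
    (hs : s ≤ s') (j : ℕ) (hj : j < k + 1) : Function.update pos k v j < s' := by
  rcases Nat.lt_succ_iff_lt_or_eq.1 hj with hj | rfl
  · rw [Function.update_of_ne hj.ne]
    exact (h j hj).trans_le hs
  · rwa [Function.update_self]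

theorem Loads.eval_slot (h : Loads m w) (s : ℕ) : (slot s).eval m = w.length + (s + 1) := by
  simp [slot, Expr.eval, h.length]

theorem Loads.eval_get (h : Loads m w) (s : ℕ) :
    (get s).eval m = m (w.length + (s + 1)) := by
  simp [get, Expr.eval, h.eval_slot]

theorem Loads.runs_put (h : Loads m w) (s : ℕ) (e : Expr) :
    Runs (put s e) m (e.cost + 5) (Function.update m (w.length + (s + 1)) (e.eval m)) := by
  have hcost : e.cost + 5 = (slot s).cost + e.cost + 1 := by simp only [slot, Expr.cost]; omega
  rw [← h.eval_slot, hcost]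
  exact .store (slot s) e m

theorem Loads.yields_put (h : Loads m w) (s : ℕ) (e : Expr) :
    Yields (put s e) m w s (e.eval m) (e.cost + 5) :=
  ⟨_, _, le_rfl, h.runs_put s e, Function.update_self .., fun _ hi =>
    Function.update_of_ne hi.ne ..⟩

theorem Yields.seq {p q : Prog} {s' v v' T T' : ℕ} (hp : Yields p m w s v T) (hs : s' ≤ s)
    (hq : ∀ m', m' (w.length + (s + 1)) = v → (∀ i < w.length + (s + 1), m' i = m i) →
      Yields q m' w s' v' T') :
    Yields (p.seq q) m w s' v' (T + T') := by
  obtain ⟨t, m', ht, hr, hv, hb⟩ := hp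
  obtain ⟨t', m'', ht', hr', hv', hb'⟩ := hq m' hv hb
  exact ⟨t + t', m'', by omega, .seq hr hr', hv', fun i hi => by rw [hb' i hi, hb i (by omega)]⟩

theorem Yields.ite_true {p q : Prog} {e : Expr} {v T : ℕ} (he : e.eval m ≠ 0)
    (hp : Yields p m w s v T) : Yields (.ite e p q) m w s v (e.cost + 1 + T) := by
  obtain ⟨t, m', ht, hr, h⟩ := hp
  exact ⟨_, m', by omega, .ite_true he hr, h⟩

theorem Yields.ite_false {p q : Prog} {e : Expr} {v T : ℕ} (he : e.eval m = 0)
    (hq : Yields q m w s v T) : Yields (.ite e p q) m w s v (e.cost + 1 + T) := by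
  obtain ⟨t, m', ht, hr, h⟩ := hq
  exact ⟨_, m', by omega, .ite_false he hr, h⟩

theorem Yields.mono {p : Prog} {v T T' : ℕ} (h : Yields p m w s v T) (hT : T ≤ T') :
    Yields p m w s v T' := by
  obtain ⟨t, m', ht, h⟩ := h
  exact ⟨t, m', ht.trans hT, h⟩

end Slots

section Loops

theorem runs_loop_of_invariant {e : Expr} {p : Prog} {I : ℕ → Mem → Prop} {n T : ℕ}
    (hn : ∀ m, I n m → e.eval m = 0) (hlt : ∀ i < n, ∀ m, I i m → e.eval m ≠ 0)
    (hstep : ∀ i < n, ∀ m, I i m → ∃ t m', t ≤ T ∧ Runs p m t m' ∧ I (i + 1) m') {i : ℕ}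
    (hi : i ≤ n) : ∀ m, I i m → ∃ t m',
      t ≤ (n - i) * (e.cost + 1 + T) + (e.cost + 1) ∧ Runs (.loop e p) m t m' ∧ I n m' := by
  induction hi using Nat.decreasingInduction with
  | self => exact fun m hm => ⟨_, m, Nat.le_add_left _ _, .loop_done (hn m hm), hm⟩
  | of_succ i hi ih =>
    intro m hm
    obtain ⟨t, m', ht, hr, hm'⟩ := hstep i hi m hm
    obtain ⟨t', m'', ht', hr', hm''⟩ := ih m' hm'
    refine ⟨_, m'', ?_, .loop_step (hlt i hi m hm) hr hr', hm''⟩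
    rw [show n - i = n - (i + 1) + 1 by omega, add_one_mul]
    omega

/-- The memory during a counting loop that started on `m₀`: the number `n` of rounds is in slot
`s`, the current value `v` in slot `s + 1`, and the number `i` of completed rounds in slot
`s + 2`. -/
structure LoopState (m₀ : Mem) (w : List Bool) (s n i v : ℕ) (m : Mem) : Prop where
  below : ∀ j < w.length + (s + 1), m j = m₀ j
  rounds : m (w.length + (s + 1)) = n
  value : m (w.length + (s + 2)) = v
  index : m (w.length + (s + 3)) = i

/-- One round of a counting loop whose next value is computed by `q` in slot `s + 3`. -/
def loopBody (s : ℕ) (q : Prog) : Prog :=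
  q.seq ((put (s + 1) (get (s + 3))).seq (put (s + 2) (.add (get (s + 2)) (.const 1))))

/-- The test of a counting loop. -/
def loopTest (s : ℕ) : Expr := .sub (get s) (get (s + 2))

variable {m₀ m : Mem} {w : List Bool} {s n i v v' T : ℕ}

theorem LoopState.eval_loopTest (h : LoopState m₀ w s n i v m) (h₀ : Loads m₀ w) :
    (loopTest s).eval m = n - i := by
  have hm := h₀.congr h.below
  rw [loopTest, Expr.eval, hm.eval_get, hm.eval_get, h.rounds, h.index]

theorem LoopState.exists_runs_loopBody {q : Prog} (h : LoopState m₀ w s n i v m)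
    (h₀ : Loads m₀ w) (hq : Yields q m w (s + 3) v' T) :
    ∃ t m', t ≤ T + 22 ∧ Runs (loopBody s q) m t m' ∧ LoopState m₀ w s n (i + 1) v' m' := by
  obtain ⟨t, m₁, ht, hr, hv, hb⟩ := hq
  have l₁ : Loads m₁ w := (h₀.congr h.below).congr hb
  have r₂ := l₁.runs_put (s + 1) (get (s + 3))
  rw [l₁.eval_get, hv] at r₂
  have l₂ : Loads (Function.update m₁ (w.length + (s + 1 + 1)) v') w :=
    l₁.congr fun j hj => Function.update_of_ne hj.ne ..
  have r₃ := l₂.runs_put (s + 2) (.add (get (s + 2)) (.const 1))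
  rw [Expr.eval, l₂.eval_get, Function.update_of_ne (by omega), hb _ (by omega), h.index,
    Expr.eval] at r₃
  refine ⟨_, _, ?_, .seq hr (.seq r₂ r₃), fun j hj => ?_, ?_, ?_, Function.update_self ..⟩
  · simp only [Expr.cost, cost_get]
    omega
  · rw [Function.update_of_ne (by omega), Function.update_of_ne (by omega), hb _ (by omega),
      h.below j hj]
  · rw [Function.update_of_ne (by omega), Function.update_of_ne (by omega), hb _ (by omega),
      h.rounds]
  · rw [Function.update_of_ne (by omega)]
    exact Function.update_self ..

theorem exists_runs_loop {q : Prog} {r : ℕ → ℕ} (h₀ : Loads m₀ w)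
    (hq : ∀ i < n, ∀ m, LoopState m₀ w s n i (r i) m → Yields q m w (s + 3) (r (i + 1)) T)
    (h : LoopState m₀ w s n 0 (r 0) m) :
    ∃ t m', t ≤ n * (T + 34) + 12 ∧ Runs (.loop (loopTest s) (loopBody s q)) m t m' ∧
      LoopState m₀ w s n n (r n) m' := by
  obtain ⟨t, m', ht, hr, h'⟩ := runs_loop_of_invariant
    (I := fun i => LoopState m₀ w s n i (r i)) (e := loopTest s)
    (fun m hm => by rw [hm.eval_loopTest h₀, Nat.sub_self])
    (fun i hi m hm => by rw [hm.eval_loopTest h₀]; omega)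
    (fun i hi m hm => hm.exists_runs_loopBody h₀ (hq i hi m hm)) n.zero_le m h
  refine ⟨t, m', ht.trans_eq ?_, hr, h'⟩
  rw [Nat.sub_zero]
  simp only [loopTest, Expr.cost, cost_get]
  ring

end Loops

/-- The function `f` on a context is computed by a program in time polynomial in the resource
`B`. The program is given for every layout `pos` of the variables below its target slot `s`. -/
def ComputableWithin {α : Type} [Context α] (B : List Bool → ℕ) (f : α → ℕ) : Prop :=
  ∃ (p : (ℕ → ℕ) → ℕ → Prog) (T : List Bool → ℕ), PolyBounded B T ∧
    ∀ (pos : ℕ → ℕ) (s : ℕ) (a : α) (m : Mem), (∀ j < Context.size α, pos j < s) →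
      Holds m pos a → Yields (p pos s) m (Context.word a) s (f a) (T (Context.word a))

/-- The function `n` is computable within the resource `B`, with values polynomially bounded in
`B`, so that loops may be run `n` times. -/
def SmallWithin {α : Type} [Context α] (B : List Bool → ℕ) (n : α → ℕ) : Prop :=
  ComputableWithin B n ∧ ∃ N, PolyBounded B N ∧ ∀ a, n a ≤ N (Context.word a)

open Classical in
/-- The predicate `P` on a context is decided by a program in time polynomial in the resource
`B`. -/
def DecidableWithin {α : Type} [Context α] (B : List Bool → ℕ) (P : α → Prop) : Prop :=
  ComputableWithin B fun a => if P a then 1 else 0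

variable {α : Type} [Context α] {B : List Bool → ℕ} {f g n : α → ℕ} {P Q : α → Prop}

namespace ComputableWithin

theorem of_eq (hf : ComputableWithin B f) (h : ∀ a, f a = g a) : ComputableWithin B g :=
  funext h ▸ hf

theorem const (c : ℕ) : ComputableWithin B fun _ : α => c :=
  ⟨fun _ s => put s (.const c), fun _ => 6, .const _, fun _ s _ _ _ h =>
    h.1.yields_put s (.const c)⟩

theorem length : ComputableWithin B fun a : α => (Context.word a).length := by
  refine ⟨fun _ s => put s (.read (.const 0)), fun _ => 7, .const _, fun pos s a m _ h => ?_⟩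
  have hput := h.1.yields_put s (.read (.const 0))
  rwa [Expr.eval, Expr.eval, h.1.length] at hput

theorem last : ComputableWithin B fun p : α × ℕ => p.2 := by
  refine ⟨fun pos s => put s (get (pos (Context.size α))), fun _ => 10, .const _,
    fun pos s a m _ h => ?_⟩
  have hput := h.1.yields_put s (get (pos (Context.size α)))
  have hvar : Context.var a (Context.size α) = a.2 := if_pos rfl
  rwa [h.1.eval_get, h.2 _ (Nat.lt_succ_self _), hvar] at hput

theorem weaken (hf : ComputableWithin B f) : ComputableWithin B fun p : α × ℕ => f p.1 := by
  obtain ⟨p, T, hT, hp⟩ := hf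
  refine ⟨p, T, hT, fun pos s a m hs h => ?_⟩
  refine hp pos s a.1 m (fun j hj => hs j (Nat.lt_succ_of_lt hj)) ⟨h.1, fun j hj => ?_⟩
  simpa [Context.var, Context.word, hj.ne] using h.2 j (Nat.lt_succ_of_lt hj)

theorem of_expr {op : ℕ → ℕ → ℕ} {c : Expr → Expr → Expr}
    (hc : ∀ m e e', (c e e').eval m = op (e.eval m) (e'.eval m))
    (hcost : ∀ e e', (c e e').cost = e.cost + e'.cost + 1)
    (hf : ComputableWithin B f) (hg : ComputableWithin B g) :
    ComputableWithin B fun a => op (f a) (g a) := by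
  obtain ⟨p, T, hT, hp⟩ := hf
  obtain ⟨q, T', hT', hq⟩ := hg
  refine ⟨fun pos s => (p pos s).seq ((q pos (s + 1)).seq (put s (c (get s) (get (s + 1))))),
    fun w => T w + (T' w + 16), hT.add (hT'.add (.const _)), fun pos s a m hs h => ?_⟩
  refine (hp pos s a m hs h).seq le_rfl fun m' hv hb => ?_
  have h' := h.congr hs hb
  refine (hq pos (s + 1) a m' (fun j hj => (hs j hj).trans s.lt_succ_self) h').seq
    s.le_succ fun m'' hv' hb' => ?_
  have h'' : Loads m'' (Context.word a) := h'.1.congr hb'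
  have hput := h''.yields_put s (c (get s) (get (s + 1)))
  rwa [hc, h''.eval_get, h''.eval_get, hv', hb' _ (by omega), hv, hcost] at hput

theorem add (hf : ComputableWithin B f) (hg : ComputableWithin B g) :
    ComputableWithin B fun a => f a + g a :=
  of_expr (c := .add) (fun _ _ _ => rfl) (fun _ _ => rfl) hf hg

theorem sub (hf : ComputableWithin B f) (hg : ComputableWithin B g) :
    ComputableWithin B fun a => f a - g a :=
  of_expr (c := .sub) (fun _ _ _ => rfl) (fun _ _ => rfl) hf hg

theorem letter (hf : ComputableWithin B f) :
    ComputableWithin B fun a => ((Context.word a).getD (f a) false).toNat := by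
  obtain ⟨p, T, hT, hp⟩ := hf
  refine ⟨fun pos s => (p pos s).seq (.ite (.sub (.read (.const 0)) (get s))
    (put s (.read (.add (get s) (.const 1)))) (put s (.const 0))),
    fun w => T w + 22, hT.add (.const _), fun pos s a m hs h => ?_⟩
  refine (hp pos s a m hs h).seq le_rfl fun m' hv hb => ?_
  have h' : Loads m' (Context.word a) := h.1.congr hb
  rcases lt_or_ge (f a) (Context.word a).length with hlt | hge
  · have hput := h'.yields_put s (.read (.add (get s) (.const 1)))
    simp only [Expr.eval, h'.eval_get, hv, h'.letter _ hlt] at hput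
    refine (hput.ite_true ?_).mono (by simp [Expr.cost, cost_get])
    simp only [Expr.eval, h'.eval_get, hv, h'.length]
    omega
  · simp only [List.getD_eq_default _ _ hge]
    refine ((h'.yields_put s (.const 0)).ite_false ?_).mono (by simp [Expr.cost, cost_get])
    simp only [Expr.eval, h'.eval_get, hv, h'.length]
    omega

theorem cond {c : α → ℕ} (hc : ComputableWithin B c) (hf : ComputableWithin B f)
    (hg : ComputableWithin B g) : ComputableWithin B fun a => if c a ≠ 0 then f a else g a := by
  obtain ⟨r, T₀, hT₀, hr⟩ := hc
  obtain ⟨p, T, hT, hp⟩ := hf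
  obtain ⟨q, T', hT', hq⟩ := hg
  refine ⟨fun pos s => (r pos s).seq (.ite (get s) (p pos s) (q pos s)),
    fun w => T₀ w + (6 + (T w + T' w)), hT₀.add ((PolyBounded.const _).add (hT.add hT')),
    fun pos s a m hs h => ?_⟩
  refine (hr pos s a m hs h).seq le_rfl fun m' hv hb => ?_
  have h' := h.congr hs hb
  have hget : (get s).eval m' = c a := by rw [h'.1.eval_get, hv]
  dsimp only
  split_ifs with hca
  · exact ((hp pos s a m' hs h').ite_true (hget ▸ hca)).mono (by rw [cost_get]; omega)
  · exact ((hq pos s a m' hs h').ite_false (hget ▸ not_not.1 hca)).mono (by rw [cost_get]; omega)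

theorem natRec (hn : SmallWithin B n) {b : α → ℕ → ℕ → ℕ} (hf : ComputableWithin B f)
    (hb : ComputableWithin B fun p : (α × ℕ) × ℕ => b p.1.1 p.1.2 p.2) :
    ComputableWithin B fun a => Nat.rec (motive := fun _ => ℕ) (f a) (b a) (n a) := by
  obtain ⟨⟨r, T₀, hT₀, hr⟩, N, hN, hle⟩ := hn
  obtain ⟨p, T, hT, hp⟩ := hf
  obtain ⟨q, T', hT', hq⟩ := hb
  let layout (pos : ℕ → ℕ) (s : ℕ) : ℕ → ℕ :=
    Function.update (Function.update pos (Context.size α) (s + 2)) (Context.size α + 1) (s + 1)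
  refine ⟨fun pos s => (r pos s).seq ((p pos (s + 1)).seq ((put (s + 2) (.const 0)).seq
    ((Prog.loop (loopTest s) (loopBody s (q (layout pos s) (s + 3)))).seq
      (put s (get (s + 1)))))),
    fun w => T₀ w + (T w + (6 + (N w * (T' w + 34) + 22))),
    hT₀.add (hT.add ((PolyBounded.const _).add ((hN.mul (hT'.add (.const _))).add (.const _)))),
    fun pos s a m hs h => ?_⟩
  refine (hr pos s a m hs h).seq le_rfl fun m₁ hv₁ hb₁ => ?_
  have h₁ := h.congr hs hb₁
  have hs' : ∀ j < Context.size α, pos j < s + 1 := fun j hj => (hs j hj).trans s.lt_succ_self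
  refine (hp pos (s + 1) a m₁ hs' h₁).seq s.le_succ fun m₂ hv₂ hb₂ => ?_
  have h₂ := h₁.congr hs' hb₂
  refine (h₂.1.yields_put (s + 2) (.const 0)).seq (by omega) fun m₃ hv₃ hb₃ => ?_
  have h₃ : Holds m₃ pos a := h₂.congr hs fun i hi => hb₃ i (by omega)
  have hstart : LoopState m₃ (Context.word a) s (n a) 0 (f a) m₃ :=
    ⟨fun _ _ => rfl, by rw [hb₃ _ (by omega), hb₂ _ (by omega), hv₁],
      by rw [hb₃ _ (by omega)]; exact hv₂, hv₃⟩
  obtain ⟨t, m₄, ht, hr₄, h₄⟩ := exists_runs_loop (T := T' (Context.word a))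
    (q := q (layout pos s) (s + 3)) (r := Nat.rec (motive := fun _ => ℕ) (f a) (b a)) h₃.1
    (fun i _ m' hm' => hq (layout pos s) (s + 3) ((a, i), _) m'
      (update_lt (s := s + 3) (update_lt hs (by omega) (by omega)) (by omega) le_rfl)
      (((h₃.congr hs hm'.below).push hm'.index).push hm'.value)) hstart
  have l₄ : Loads m₄ (Context.word a) := h₃.1.congr h₄.below
  obtain ⟨t₅, m₅, ht₅, hr₅, hv₅, hb₅⟩ := l₄.yields_put s (get (s + 1))
  refine ⟨_, m₅, ?_, .seq hr₄ hr₅, ?_, fun i hi => (hb₅ i hi).trans (h₄.below i hi)⟩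
  · have := Nat.mul_le_mul_right (T' (Context.word a) + 34) (hle a)
    rw [cost_get] at ht₅
    omega
  · rw [hv₅, l₄.eval_get]
    exact h₄.value

theorem exists_prog {f : List Bool → ℕ} (hf : ComputableWithin B f) :
    ∃ (p : Prog) (T : List Bool → ℕ), PolyBounded B T ∧ ∀ w, ∃ t m', t ≤ T w ∧
      Runs p (initMem w) t m' ∧ m' 0 = f w := by
  obtain ⟨p, T, hT, hp⟩ := hf
  refine ⟨(p id 0).seq (.store (.const 0) (get 0)), fun w => T w + 7, hT.add (.const 7),
    fun w => ?_⟩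
  obtain ⟨t, m', ht, hr, hv, hb⟩ := hp id 0 w (initMem w)
    (fun j hj => absurd hj (Nat.not_lt_zero _))
    ⟨loads_initMem w, fun j hj => absurd hj (Nat.not_lt_zero _)⟩
  refine ⟨_, _, Nat.add_le_add_right ht _, .seq hr (.store (.const 0) (get 0) m'), ?_⟩
  rw [Expr.eval, Function.update_self, ((loads_initMem w).congr hb).eval_get]
  exact hv

end ComputableWithin

theorem ComputableWithin.ite [DecidablePred P] (hP : DecidableWithin B P)
    (hf : ComputableWithin B f) (hg : ComputableWithin B g) :
    ComputableWithin B fun a => if P a then f a else g a :=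
  (hP.cond hf hg).of_eq fun a => by by_cases h : P a <;> simp [h]

namespace DecidableWithin

theorem of_iff (hP : DecidableWithin B P) (h : ∀ a, P a ↔ Q a) : DecidableWithin B Q :=
  funext (fun a => propext (h a)) ▸ hP

theorem ne_zero (hf : ComputableWithin B f) : DecidableWithin B fun a => f a ≠ 0 :=
  (hf.cond (.const 1) (.const 0)).of_eq fun a => by by_cases h : f a = 0 <;> simp [h]

theorem not (hP : DecidableWithin B P) : DecidableWithin B fun a => ¬ P a :=
  (ne_zero ((ComputableWithin.const 1).sub hP)).of_iff fun a => by by_cases h : P a <;> simp [h]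

theorem and (hP : DecidableWithin B P) (hQ : DecidableWithin B Q) :
    DecidableWithin B fun a => P a ∧ Q a :=
  (ne_zero (hP.cond hQ (.const 0))).of_iff fun a => by
    by_cases h : P a <;> by_cases h' : Q a <;> simp [h, h']

theorem or (hP : DecidableWithin B P) (hQ : DecidableWithin B Q) :
    DecidableWithin B fun a => P a ∨ Q a :=
  (hP.not.and hQ.not).not.of_iff fun a => by tauto

theorem imp (hP : DecidableWithin B P) (hQ : DecidableWithin B Q) :
    DecidableWithin B fun a => P a → Q a :=
  (hP.and hQ.not).not.of_iff fun a => by tauto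

theorem lt (hf : ComputableWithin B f) (hg : ComputableWithin B g) :
    DecidableWithin B fun a => f a < g a :=
  (ne_zero (hg.sub hf)).of_iff fun a => by omega

theorem le (hf : ComputableWithin B f) (hg : ComputableWithin B g) :
    DecidableWithin B fun a => f a ≤ g a :=
  (lt hg hf).not.of_iff fun _ => not_lt

theorem eq (hf : ComputableWithin B f) (hg : ComputableWithin B g) :
    DecidableWithin B fun a => f a = g a :=
  ((le hf hg).and (le hg hf)).of_iff fun _ => le_antisymm_iff.symm

end DecidableWithin

namespace ComputableWithin

theorem min (hf : ComputableWithin B f) (hg : ComputableWithin B g) :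
    ComputableWithin B fun a => min (f a) (g a) :=
  (hf.sub (hf.sub hg)).of_eq fun a => by omega

theorem max (hf : ComputableWithin B f) (hg : ComputableWithin B g) :
    ComputableWithin B fun a => max (f a) (g a) :=
  (hf.add (hg.sub hf)).of_eq fun a => by omega

theorem last₂ : ComputableWithin B fun p : (α × ℕ) × ℕ => p.1.2 := last.weaken

theorem last₃ : ComputableWithin B fun p : ((α × ℕ) × ℕ) × ℕ => p.1.1.2 := last₂.weaken

theorem sum (hn : SmallWithin B n) {h : α → ℕ → ℕ}
    (hh : ComputableWithin B fun p : α × ℕ => h p.1 p.2) :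
    ComputableWithin B fun a => ∑ i ∈ range (n a), h a i :=
  (natRec hn (.const 0) (b := fun a i acc => acc + h a i) (last.add hh.weaken)).of_eq fun a => by
    induction n a with
    | zero => rfl
    | succ k ih => rw [sum_range_succ, ← ih]

theorem sup (hn : SmallWithin B n) {h : α → ℕ → ℕ}
    (hh : ComputableWithin B fun p : α × ℕ => h p.1 p.2) :
    ComputableWithin B fun a => (range (n a)).sup (h a) :=
  (natRec hn (.const 0) (b := fun a i acc => Max.max (h a i) acc)
    (hh.weaken.max last)).of_eq fun a => by
    induction n a with
    | zero => rfl
    | succ k ih => rw [range_add_one, sup_insert, ← ih]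

theorem card_filter (hn : SmallWithin B n) {R : α → ℕ → Prop} [∀ a, DecidablePred (R a)]
    (hR : DecidableWithin B fun p : α × ℕ => R p.1 p.2) :
    ComputableWithin B fun a => #{i ∈ range (n a) | R a i} := by
  classical
  exact (sum hn (h := fun a i => if R a i then 1 else 0) (hR.of_eq fun a => by congr)).of_eq
    fun a => by rw [Finset.card_filter]

theorem mul (hn : SmallWithin B n) (hf : ComputableWithin B f) :
    ComputableWithin B fun a => n a * f a :=
  (sum hn (h := fun a _ => f a) hf.weaken).of_eq fun a => by simp

theorem pow (hf : SmallWithin B f) (hn : SmallWithin B n) :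
    ComputableWithin B fun a => f a ^ n a := by
  have hf' : SmallWithin B fun p : (α × ℕ) × ℕ => f p.1.1 :=
    ⟨hf.1.weaken.weaken, hf.2.imp fun _ h => ⟨h.1, fun p => h.2 p.1.1⟩⟩
  refine (natRec hn (.const 1) (b := fun a _ acc => f a * acc) (mul hf' last)).of_eq fun a => ?_
  induction n a with
  | zero => rfl
  | succ k ih => rw [pow_succ', ← ih]

theorem mul_two_pow (hn : SmallWithin B n) (hf : ComputableWithin B f) :
    ComputableWithin B fun a => f a * 2 ^ n a := by
  refine (natRec hn hf (b := fun _ _ acc => acc + acc) (last.add last)).of_eq fun a => ?_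
  induction n a with
  | zero => simp
  | succ k ih => rw [pow_succ, ← mul_assoc, ← ih, mul_two]

end ComputableWithin

namespace DecidableWithin

theorem exists_lt (hn : SmallWithin B n) {R : α → ℕ → Prop}
    (hR : DecidableWithin B fun p : α × ℕ => R p.1 p.2) :
    DecidableWithin B fun a => ∃ i < n a, R a i := by
  classical
  refine (ne_zero (.card_filter hn hR)).of_iff fun a => ?_
  simp only [card_ne_zero, Finset.Nonempty, mem_filter, mem_range]

theorem forall_lt (hn : SmallWithin B n) {R : α → ℕ → Prop}
    (hR : DecidableWithin B fun p : α × ℕ => R p.1 p.2) :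
    DecidableWithin B fun a => ∀ i < n a, R a i :=
  (exists_lt hn (R := fun a i => ¬ R a i) hR.not).not.of_iff fun a => by
    push Not; rfl

end DecidableWithin

namespace SmallWithin

theorem const (c : ℕ) : SmallWithin B fun _ : α => c :=
  ⟨.const c, fun _ => c, .const c, fun _ => le_rfl⟩

theorem add (hf : SmallWithin B f) (hg : SmallWithin B g) : SmallWithin B fun a => f a + g a := by
  obtain ⟨h, N, hN, hle⟩ := hf
  obtain ⟨h', N', hN', hle'⟩ := hg
  exact ⟨h.add h', _, hN.add hN', fun a => add_le_add (hle a) (hle' a)⟩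

theorem mul (hf : SmallWithin B f) (hg : SmallWithin B g) : SmallWithin B fun a => f a * g a := by
  have hfg := ComputableWithin.mul hf hg.1
  obtain ⟨-, N, hN, hle⟩ := hf
  obtain ⟨-, N', hN', hle'⟩ := hg
  exact ⟨hfg, _, hN.mul hN', fun a => Nat.mul_le_mul (hle a) (hle' a)⟩

theorem of_le (hf : ComputableWithin B f) (hg : SmallWithin B g) (h : ∀ a, f a ≤ g a) :
    SmallWithin B f := by
  obtain ⟨-, N, hN, hle⟩ := hg
  exact ⟨hf, N, hN, fun a => (h a).trans (hle a)⟩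

theorem weaken (hn : SmallWithin B n) : SmallWithin B fun p : α × ℕ => n p.1 :=
  ⟨hn.1.weaken, hn.2.imp fun _ h => ⟨h.1, fun p => h.2 p.1⟩⟩

theorem length (hB : ∀ w, w.length ≤ B w) : SmallWithin B fun a : α => (Context.word a).length :=
  ⟨.length, B, .self, fun _ => hB _⟩

end SmallWithin

section Digits

/-- Long division by a machine without multiplication: `q` runs through the multiples
`y * 2 ^ (l - 1), …, y * 2, y`, each of which is subtracted if possible. -/
def longDivision (x y l : ℕ) : ℕ → ℕ :=
  Nat.rec x fun j r => if y * 2 ^ (l - 1 - j) ≤ r then r - y * 2 ^ (l - 1 - j) else r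

theorem longDivision_spec {x y l : ℕ} (h : x < y * 2 ^ l) {j : ℕ} (hj : j ≤ l) :
    longDivision x y l j < y * 2 ^ (l - j) ∧ longDivision x y l j % y = x % y := by
  induction j with
  | zero => exact ⟨h, rfl⟩
  | succ j ih =>
    obtain ⟨hlt, hmod⟩ := ih (by omega)
    rw [show l - j = l - 1 - j + 1 by omega, pow_succ, ← mul_assoc] at hlt
    rw [show l - (j + 1) = l - 1 - j by omega]
    change (if y * 2 ^ (l - 1 - j) ≤ longDivision x y l j
        then longDivision x y l j - y * 2 ^ (l - 1 - j) else longDivision x y l j) < _ ∧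
      (if y * 2 ^ (l - 1 - j) ≤ longDivision x y l j
        then longDivision x y l j - y * 2 ^ (l - 1 - j) else longDivision x y l j) % y = _
    split_ifs with hle
    · exact ⟨by omega, (Nat.sub_mul_mod hle).trans hmod⟩
    · exact ⟨by omega, hmod⟩

theorem longDivision_eq_mod {x y l : ℕ} (h : x < y * 2 ^ l) : longDivision x y l l = x % y := by
  obtain ⟨hlt, hmod⟩ := longDivision_spec h le_rfl
  rw [Nat.sub_self, pow_zero, mul_one] at hlt
  rw [← hmod, Nat.mod_eq_of_lt hlt]

theorem ComputableWithin.mod (hn : SmallWithin B n) (hf : ComputableWithin B f)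
    (hg : ComputableWithin B g) (h : ∀ a, f a < g a * 2 ^ n a) :
    ComputableWithin B fun a => f a % g a := by
  have hsub : ComputableWithin B fun p : (α × ℕ) × ℕ => g p.1.1 * 2 ^ (n p.1.1 - 1 - p.1.2) :=
    mul_two_pow (.of_le ((hn.1.weaken.weaken.sub (.const 1)).sub last₂) hn.weaken.weaken
      fun a => by omega) hg.weaken.weaken
  exact (natRec hn hf (b := fun a j r => if g a * 2 ^ (n a - 1 - j) ≤ r
    then r - g a * 2 ^ (n a - 1 - j) else r)
    (.ite (.le hsub last) (last.sub hsub) last)).of_eq fun a => longDivision_eq_mod (h a)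

theorem card_filter_mul_le_mod {b x y : ℕ} (hb : 0 < b) (hy : 0 < y) :
    #{q ∈ range b | (q + 1) * y ≤ x % (y * b)} = x / y % b := by
  have hlt := Nat.mod_lt (x / y) hb
  rw [← Nat.mod_mul_right_div_self] at hlt ⊢
  refine Eq.trans (congrArg card ?_) (card_range _)
  ext q
  rw [mem_filter, mem_range, mem_range, ← Nat.le_div_iff_mul_le hy]
  omega

theorem ComputableWithin.div_pow_mod {b x i : α → ℕ} (hb : SmallWithin B b)
    (hb₀ : ∀ a, 0 < b a) (hi : SmallWithin B i) (hn : SmallWithin B n)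
    (hx : ComputableWithin B x) (hxn : ∀ a, x a < 2 ^ n a) :
    ComputableWithin B fun a => x a / b a ^ i a % b a := by
  have hmod := ComputableWithin.mod hn hx (.pow hb (hi.add (.const 1))) fun a =>
    (hxn a).trans_le (Nat.le_mul_of_pos_left _ (Nat.pow_pos (hb₀ a)))
  have hmul : ComputableWithin B fun p : α × ℕ => Min.min (p.2 + 1) (b p.1) * b p.1 ^ i p.1 :=
    mul (.of_le ((last.add (const 1)).min hb.1.weaken) hb.weaken fun a => min_le_right ..)
      (pow hb hi).weaken
  refine (card_filter hb (R := fun a q => Min.min (q + 1) (b a) * b a ^ i a ≤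
    x a % b a ^ (i a + 1)) (.le hmul hmod.weaken)).of_eq fun a => ?_
  rw [← card_filter_mul_le_mod (hb₀ a) (Nat.pow_pos (hb₀ a))]
  refine congrArg card (filter_congr fun q hq => ?_)
  rw [min_eq_left (mem_range.1 hq), pow_succ]

/-- The `i`-th digit of `x` in base `b`, with the arguments clipped so that `b` and `i` are at most
`l` and `x` has at most `l` binary digits. -/
def clippedDigit (l b x i : ℕ) : ℕ :=
  min x (2 ^ l - 1) / max 1 (min b l) ^ min i l % max 1 (min b l)

theorem clippedDigit_eq {l b x i : ℕ} (hb₀ : 0 < b) (hb : b ≤ l) (hx : x < 2 ^ l) (hi : i ≤ l) :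
    clippedDigit l b x i = x / b ^ i % b := by
  rw [clippedDigit, min_eq_left hb, max_eq_right hb₀, min_eq_left (by omega), min_eq_left hi]

theorem ComputableWithin.clippedDigit {x i : α → ℕ} (hn : SmallWithin B n)
    (hf : ComputableWithin B f) (hx : ComputableWithin B x) (hi : ComputableWithin B i) :
    ComputableWithin B fun a => clippedDigit (n a) (f a) (x a) (i a) := by
  refine div_pow_mod
    (.of_le ((const 1).max (hf.min hn.1)) ((SmallWithin.const 1).add hn) fun a => by omega)
    (fun a => by omega) (.of_le (hi.min hn.1) hn fun a => min_le_right ..) hn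
    (hx.min (((mul_two_pow hn (const 1)).of_eq fun a => one_mul _).sub (const 1))) fun a => ?_
  have := Nat.one_le_two_pow (n := n a)
  omega

theorem SmallWithin.clippedDigit {x i : α → ℕ} (hn : SmallWithin B n)
    (hf : ComputableWithin B f) (hx : ComputableWithin B x) (hi : ComputableWithin B i) :
    SmallWithin B fun a => clippedDigit (n a) (f a) (x a) (i a) :=
  .of_le (.clippedDigit hn hf hx hi) ((const 1).add hn) fun a =>
    (Nat.mod_lt _ (by omega)).le.trans (by omega)

end Digits

end RAM

/-! ### The algorithm -/

namespace EqColAlg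

open Finset RAM CliqueColoring

section Digits

theorem exists_digits_eq {b l : ℕ} (f : Fin l → Fin b) :
    ∃ y < b ^ l, ∀ i : Fin l, y / b ^ (i : ℕ) % b = f i := by
  refine ⟨finFunctionFinEquiv f, (finFunctionFinEquiv f).2, fun i => ?_⟩
  rw [← finFunctionFinEquiv_symm_apply_val, Equiv.symm_apply_apply]

theorem nth_mem_of_lt_count {p : ℕ → Prop} [DecidablePred p] {j n : ℕ} (hj : j < Nat.count p n) :
    p (Nat.nth p j) := by
  refine Nat.nth_mem j fun hf => hj.trans_le ?_
  rw [Nat.count_eq_card_filter_range]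
  exact card_le_card fun i hi => hf.mem_toFinset.2 (mem_filter.1 hi).2

theorem exists_digits_count_eq {p : ℕ → Prop} [DecidablePred p] {b n : ℕ} {f : ℕ → ℕ}
    (hf : ∀ i < n, p i → f i < b) :
    ∃ y < b ^ Nat.count p n, ∀ i < n, p i → y / b ^ Nat.count p i % b = f i := by
  obtain ⟨y, hy, h⟩ := exists_digits_eq fun j : Fin (Nat.count p n) =>
    (⟨f (Nat.nth p j), hf _ (Nat.nth_lt_of_lt_count j.2) (nth_mem_of_lt_count j.2)⟩ : Fin b)
  refine ⟨y, hy, fun i hi hpi => ?_⟩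
  simpa only [Nat.nth_count hpi] using h ⟨Nat.count p i, Nat.count_strict_mono hpi hi⟩

end Digits

section Greedy

variable {α : Type*} [DecidableEq α] {P : ℕ → Finset α}

/-- Go through the sets `P 0, P 1, …` and collect all elements of those that are disjoint from the
elements collected before. -/
def greedyHittingSet (P : ℕ → Finset α) : ℕ → Finset α
  | 0 => ∅
  | t + 1 =>
    if Disjoint (P t) (greedyHittingSet P t) then greedyHittingSet P t ∪ P t
    else greedyHittingSet P t

theorem greedyHittingSet_mono : Monotone (greedyHittingSet P) := by
  refine monotone_nat_of_le_succ fun t => ?_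
  rw [greedyHittingSet]
  split_ifs
  exacts [subset_union_left, le_rfl]

theorem not_disjoint_greedyHittingSet {t n : ℕ} (ht : t < n) (hP : (P t).Nonempty) :
    ¬ Disjoint (P t) (greedyHittingSet P n) := by
  refine fun hdisj => ?_
  have hsucc := hdisj.mono_right (greedyHittingSet_mono (Nat.succ_le_of_lt ht))
  rw [greedyHittingSet] at hsucc
  split_ifs at hsucc with h
  · exact hP.ne_empty (disjoint_self_iff_empty _ |>.1 (hsucc.mono_right subset_union_right))
  · exact h hsucc

theorem greedyHittingSet_subset {s : Finset α} (hP : ∀ t, P t ⊆ s) (n : ℕ) :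
    greedyHittingSet P n ⊆ s := by
  induction n with
  | zero => exact empty_subset s
  | succ n ih =>
    rw [greedyHittingSet]
    split_ifs
    exacts [union_subset ih (hP n), ih]

theorem card_greedyHittingSet_le {d : ℕ} (hd : ∀ t, #(P t) ≤ d) {W : Finset α}
    (hW : ∀ t, (P t).Nonempty → ¬ Disjoint (P t) W) (n : ℕ) :
    #(greedyHittingSet P n) ≤ d * #(greedyHittingSet P n ∩ W) := by
  induction n with
  | zero => simp [greedyHittingSet]
  | succ n ih =>
    rw [greedyHittingSet]
    split_ifs with h
    · rw [union_inter_distrib_right, card_union_of_disjoint h.symm,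
        card_union_of_disjoint (h.symm.mono inter_subset_left inter_subset_left), mul_add]
      refine Nat.add_le_add ih ?_
      rcases (P n).eq_empty_or_nonempty with hn | hn
      · simp [hn]
      · exact (hd n).trans (Nat.le_mul_of_pos_right d
          (card_pos.2 (not_disjoint_iff_nonempty_inter.1 (hW n hn))))
    · exact ih

end Greedy

/-- Letter number `i` of the word is a `1`. -/
def Bit (w : List Bool) (i : ℕ) : Prop := w.getD i false = true

open Classical in
/-- The number of vertices of the input graph: the length of the leading block of `1`s. -/
noncomputable def order (w : List Bool) : ℕ :=
  #{i ∈ range w.length | ∀ j < w.length, j ≤ i → Bit w j}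

open Classical in
/-- The number of colors, read off the binary digits behind the adjacency matrix. -/
noncomputable def colors (w : List Bool) : ℕ :=
  ∑ i ∈ range w.length, if Bit w (order w + 1 + order w * order w + i) then 2 ^ i else 0

/-- The number of colors, cut off at the number of vertices so that loops over the colors are
short. -/
noncomputable def palette (w : List Bool) : ℕ := min (colors w) (order w)

/-- Adjacency in the input graph. The matrix is symmetrized, so that every word describes a
graph. -/
def Adj (w : List Bool) (u v : ℕ) : Prop :=
  u ≠ v ∧ u < order w ∧ v < order w ∧
    (Bit w (order w + 1 + (order w * u + v)) ∨ Bit w (order w + 1 + (order w * v + u)))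

/-- A bound for the bases, positions and binary lengths of the numbers of which the algorithm
takes digits. -/
def digitWidth (w : List Bool) : ℕ := w.length * (w.length + 3)

/-- The `i`-th digit of `x` in base `b`. -/
def digit (w : List Bool) (b x i : ℕ) : ℕ := clippedDigit (digitWidth w) b x i

/-- A number `t < order w ^ 3` encodes a triple of vertices, the `i`-th of which this is. -/
noncomputable def entry (w : List Bool) (t i : ℕ) : ℕ := digit w (order w) t i

/-- The triple `t` is an induced path on three vertices. -/
def IsInducedPath (w : List Bool) (t : ℕ) : Prop :=
  Adj w (entry w t 0) (entry w t 1) ∧ Adj w (entry w t 1) (entry w t 2) ∧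
    ¬Adj w (entry w t 0) (entry w t 2) ∧ entry w t 0 ≠ entry w t 2

/-- The triple `t` is disjoint from the vertex set with the bit mask `x`. -/
def Avoids (w : List Bool) (t x : ℕ) : Prop := ∀ i < 3, digit w 2 x (entry w t i) = 0

open Classical in
/-- Adds the triple `t` to the vertex set with the bit mask `x` if it is an induced path outside
of this set. -/
noncomputable def maskStep (w : List Bool) (t x : ℕ) : ℕ :=
  if IsInducedPath w t ∧ Avoids w t x then x + ∑ i ∈ range 3, 2 ^ entry w t i else x

/-- The bit mask of the modulator, the union of a maximal family of disjoint induced paths on three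
vertices. -/
noncomputable def mask (w : List Bool) : ℕ :=
  Nat.rec (motive := fun _ => ℕ) 0 (maskStep w) (order w ^ 3)

/-- Membership in the modulator, a set of vertices whose removal leaves a cluster graph. -/
def InModulator (w : List Bool) (v : ℕ) : Prop := v < order w ∧ digit w 2 (mask w) v = 1

open Classical in
/-- The number of vertices of the modulator. -/
noncomputable def modSize (w : List Bool) : ℕ := Nat.count (InModulator w) (order w)

open Classical in
/-- The number of vertices of the modulator below `v`. -/
noncomputable def rank (w : List Bool) (v : ℕ) : ℕ := Nat.count (InModulator w) v

/-- The number of codes for colorings of the modulator. -/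
noncomputable def colorCodes (w : List Bool) : ℕ := modSize w ^ modSize w

/-- The number of codes for sets of colors that are at most the size of the modulator. -/
noncomputable def setCodes (w : List Bool) : ℕ := 2 ^ modSize w

/-- The size `⌈n / k⌉` of the color classes after padding, for `k` colors and `n > k` vertices. -/
noncomputable def classSize (w : List Bool) : ℕ := #{i ∈ range (order w) | palette w * i < order w}

/-- The number of vertices after padding with a disjoint clique. -/
noncomputable def padOrder (w : List Bool) : ℕ := palette w * classSize w

/-- Adjacency after padding with a disjoint clique. -/
def PadAdj (w : List Bool) (u v : ℕ) : Prop := Adj w u v ∨ order w ≤ u ∧ order w ≤ v ∧ u ≠ v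

/-- The color of the vertex `v` of the modulator in the coloring with code `y`. -/
noncomputable def color (w : List Bool) (y v : ℕ) : ℕ := digit w (modSize w) y (rank w v)

/-- The code `y` is that of a proper coloring of the modulator. -/
def Proper (w : List Bool) (y : ℕ) : Prop :=
  ∀ u < order w, InModulator w u → color w y u < palette w ∧
    ∀ v < order w, InModulator w v → Adj w u v → color w y u ≠ color w y v

/-- The set of colors with the code `(s, j)`: the colors below the size of the modulator that are
given by the bits of `s`, and the next `j` colors. -/
def InSet (w : List Bool) (s j c : ℕ) : Prop :=
  c < modSize w ∧ digit w 2 s c = 1 ∨ modSize w ≤ c ∧ c < modSize w + j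

/-- Inclusion of the set of colors `(t, i)` in the set `(s, j)`. -/
def SubsetCode (w : List Bool) (s j t i : ℕ) : Prop :=
  ∀ c < palette w, InSet w t i c → InSet w s j c

/-- No neighbor of `v` in the modulator has the color `c`. -/
def Free (w : List Bool) (y v c : ℕ) : Prop :=
  ∀ u < order w, InModulator w u → color w y u = c → ¬PadAdj w u v

/-- The vertex `a` is the least vertex of a clique outside of the modulator. -/
def RepresentsClique (w : List Bool) (a : ℕ) : Prop :=
  ¬InModulator w a ∧ ∀ u < padOrder w, u < a → ¬InModulator w u → ¬PadAdj w u a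

/-- The vertex `v` lies in the clique of `a` outside of the modulator. -/
def InClique (w : List Bool) (a v : ℕ) : Prop := ¬InModulator w v ∧ (v = a ∨ PadAdj w a v)

open Classical in
/-- The number of colors of the set `(t, i)` minus the number of vertices in the clique of `a` for
which one of these colors is free, cut off at `0`. -/
noncomputable def shortage (w : List Bool) (y a t i : ℕ) : ℕ :=
  #{c ∈ range (palette w) | InSet w t i c} -
    #{v ∈ range (padOrder w) | InClique w a v ∧ ∃ c < palette w, InSet w t i c ∧ Free w y v c}

open Classical in
/-- The maximal shortage of a subset of the set of colors `(s, j)` in the clique of `a`. -/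
noncomputable def cliqueDeficiency (w : List Bool) (y s j a : ℕ) : ℕ :=
  (range (setCodes w)).sup fun t => (range (palette w + 1)).sup fun i =>
    if SubsetCode w s j t i then shortage w y a t i else 0

open Classical in
/-- The number of cliques outside of the modulator. -/
noncomputable def cliqueCount (w : List Bool) : ℕ :=
  #{a ∈ range (padOrder w) | RepresentsClique w a}

open Classical in
/-- The size of the color class of `c` if this color is used in all cliques. -/
noncomputable def colorSupply (w : List Bool) (y c : ℕ) : ℕ :=
  cliqueCount w + #{u ∈ range (order w) | InModulator w u ∧ color w y u = c}

open Classical in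
/-- The coloring of the modulator with code `y` extends to the padded graph with all color classes
of size `classSize w`, decided by Hall's condition. -/
def Extends (w : List Bool) (y : ℕ) : Prop :=
  (∀ c < palette w, classSize w ≤ colorSupply w y c) ∧
    ∀ s < setCodes w, ∀ j < palette w + 1,
      (∑ a ∈ range (padOrder w), if RepresentsClique w a then cliqueDeficiency w y s j a else 0) ≤
        ∑ c ∈ range (palette w), if InSet w s j c then colorSupply w y c - classSize w else 0

/-- The algorithm accepts the word. -/
def Accepts (w : List Bool) : Prop :=
  order w ≤ colors w ∨ 0 < colors w ∧ ∃ y < colorCodes w, Proper w y ∧ Extends w y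

/-- The resource in terms of which the running time is polynomial. -/
noncomputable def budget (w : List Bool) : ℕ := w.length + colorCodes w + setCodes w

section Computability

variable {α : Type} [Context α] {f g h f₁ f₂ f₃ f₄ : α → ℕ}

theorem smallWithin_length : SmallWithin budget fun a : α => (Context.word a).length :=
  .length fun w => by unfold budget; omega

theorem decidableWithin_bit (hf : ComputableWithin budget f) :
    DecidableWithin budget fun a => Bit (Context.word a) (f a) :=
  (DecidableWithin.ne_zero hf.letter).of_iff fun a => by
    simp only [ne_eq, Bool.toNat_eq_zero, Bool.not_eq_false, Bit]

open Classical in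
theorem smallWithin_order : SmallWithin budget fun a : α => order (Context.word a) :=
  .of_le ((ComputableWithin.card_filter smallWithin_length
    (R := fun a i => ∀ j < (Context.word a).length, j ≤ i → Bit (Context.word a) j)
    (.forall_lt smallWithin_length (α := α × ℕ) (R := fun p j => j ≤ p.2 → Bit (Context.word p) j)
      ((DecidableWithin.le .last .last₂).imp (decidableWithin_bit .last)))).of_eq
      fun a => by unfold order; congr) smallWithin_length
    fun _ => (card_filter_le _ _).trans (card_range _).le

theorem computableWithin_order : ComputableWithin budget fun a : α => order (Context.word a) :=
  smallWithin_order.1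

open Classical in
theorem computableWithin_colors : ComputableWithin budget fun a : α => colors (Context.word a) := by
  have hpow : ComputableWithin budget fun p : α × ℕ => 1 * 2 ^ min p.2 (Context.word p).length :=
    .mul_two_pow (.of_le (ComputableWithin.last.min .length) smallWithin_length
      fun _ => min_le_right ..) (.const 1)
  refine (ComputableWithin.sum smallWithin_length
    (h := fun a i => if Bit (Context.word a) (order (Context.word a) + 1 +
      order (Context.word a) * order (Context.word a) + i)
      then 1 * 2 ^ min i (Context.word a).length else 0)
    (.ite (decidableWithin_bit (((computableWithin_order.add (.const 1)).add
      (.mul smallWithin_order computableWithin_order)).add .last)) hpow (.const 0))).of_eq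
    fun a => sum_congr rfl fun i hi => ?_
  rw [one_mul, min_eq_left (mem_range.1 hi).le]

theorem smallWithin_palette : SmallWithin budget fun a : α => palette (Context.word a) :=
  .of_le (computableWithin_colors.min computableWithin_order) smallWithin_order
    fun _ => min_le_right ..

theorem decidableWithin_adj (hf : ComputableWithin budget f) (hg : ComputableWithin budget g) :
    DecidableWithin budget fun a => Adj (Context.word a) (f a) (g a) :=
  have hbit {f g : α → ℕ} (hf : ComputableWithin budget f) (hg : ComputableWithin budget g) :=
    decidableWithin_bit ((computableWithin_order.add (.const 1)).add
      ((ComputableWithin.mul smallWithin_order hf).add hg))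
  (DecidableWithin.eq hf hg).not.and ((DecidableWithin.lt hf computableWithin_order).and
    ((DecidableWithin.lt hg computableWithin_order).and ((hbit hf hg).or (hbit hg hf))))

theorem smallWithin_digitWidth : SmallWithin budget fun a : α => digitWidth (Context.word a) :=
  smallWithin_length.mul (smallWithin_length.add (.const 3))

theorem computableWithin_digit (hf : ComputableWithin budget f) (hg : ComputableWithin budget g)
    (hh : ComputableWithin budget h) :
    ComputableWithin budget fun a => digit (Context.word a) (f a) (g a) (h a) :=
  .clippedDigit smallWithin_digitWidth hf hg hh

theorem smallWithin_entry (hf : ComputableWithin budget f) (hg : ComputableWithin budget g) :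
    SmallWithin budget fun a => entry (Context.word a) (f a) (g a) :=
  .clippedDigit smallWithin_digitWidth computableWithin_order hf hg

theorem decidableWithin_isInducedPath (hf : ComputableWithin budget f) :
    DecidableWithin budget fun a => IsInducedPath (Context.word a) (f a) :=
  have h (i : ℕ) := (smallWithin_entry hf (.const i)).1
  (decidableWithin_adj (h 0) (h 1)).and ((decidableWithin_adj (h 1) (h 2)).and
    ((decidableWithin_adj (h 0) (h 2)).not.and (DecidableWithin.eq (h 0) (h 2)).not))

theorem decidableWithin_avoids (hf : ComputableWithin budget f) (hg : ComputableWithin budget g) :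
    DecidableWithin budget fun a => Avoids (Context.word a) (f a) (g a) :=
  .forall_lt (.const 3)
    (R := fun a i => digit (Context.word a) 2 (g a) (entry (Context.word a) (f a) i) = 0)
    (.eq (computableWithin_digit (.const 2) hg.weaken (smallWithin_entry hf.weaken .last).1)
      (.const 0))

open Classical in
theorem computableWithin_mask : ComputableWithin budget fun a : α => mask (Context.word a) := by
  have hpow : ComputableWithin budget fun p : ((α × ℕ) × ℕ) × ℕ =>
      2 ^ entry (Context.word p) p.1.1.2 p.2 :=
    (ComputableWithin.mul_two_pow (smallWithin_entry .last₃ .last) (.const 1)).of_eq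
      fun _ => one_mul _
  exact .natRec (.of_le (.pow smallWithin_order (.const 3))
      ((smallWithin_order.mul smallWithin_order).mul smallWithin_order) fun _ => (pow_three' _).le)
    (.const 0) (b := fun a => maskStep (Context.word a))
    (.ite ((decidableWithin_isInducedPath .last₂).and (decidableWithin_avoids .last₂ .last))
      (ComputableWithin.last.add (.sum (.const 3) (α := (α × ℕ) × ℕ)
        (h := fun p i => 2 ^ entry (Context.word p) p.1.2 i) hpow)) .last)

theorem decidableWithin_inModulator (hf : ComputableWithin budget f) :
    DecidableWithin budget fun a => InModulator (Context.word a) (f a) :=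
  (DecidableWithin.lt hf computableWithin_order).and
    (.eq (computableWithin_digit (.const 2) computableWithin_mask hf) (.const 1))

open Classical in
theorem smallWithin_modSize : SmallWithin budget fun a : α => modSize (Context.word a) := by
  refine .of_le ((ComputableWithin.card_filter smallWithin_order
    (R := fun a v => InModulator (Context.word a) v)
    (decidableWithin_inModulator .last)).of_eq fun a => ?_) smallWithin_order
      fun a => Nat.count_le (InModulator (Context.word a))
  rw [modSize, Nat.count_eq_card_filter_range]

theorem card_filter_lt_inModulator (w : List Bool) (v : ℕ) [DecidablePred (InModulator w)] :
    #{u ∈ range (order w) | u < v ∧ InModulator w u} = rank w v := by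
  rw [rank, Nat.count_eq_card_filter_range]
  refine congrArg card ?_
  ext u
  simp only [mem_filter, mem_range]
  exact ⟨And.right, fun h => ⟨h.2.1, h⟩⟩

open Classical in
theorem computableWithin_rank (hf : ComputableWithin budget f) :
    ComputableWithin budget fun a => rank (Context.word a) (f a) := by
  exact (ComputableWithin.card_filter smallWithin_order
    (R := fun a u => u < f a ∧ InModulator (Context.word a) u)
    ((DecidableWithin.lt .last hf.weaken).and (decidableWithin_inModulator .last))).of_eq
      fun a => card_filter_lt_inModulator ..

theorem smallWithin_colorCodes : SmallWithin budget fun a : α => colorCodes (Context.word a) :=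
  ⟨.pow smallWithin_modSize smallWithin_modSize, budget, .self, fun _ => by
    dsimp only [budget]; omega⟩

theorem smallWithin_setCodes : SmallWithin budget fun a : α => setCodes (Context.word a) :=
  ⟨.pow (.const 2) smallWithin_modSize, budget, .self, fun _ => by dsimp only [budget]; omega⟩

theorem smallWithin_classSize : SmallWithin budget fun a : α => classSize (Context.word a) :=
  .of_le (.card_filter smallWithin_order
    (R := fun a i => palette (Context.word a) * i < order (Context.word a))
    (.lt (.mul smallWithin_palette.weaken .last) computableWithin_order)) smallWithin_order
    fun _ => (card_filter_le _ _).trans (card_range _).le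

theorem smallWithin_padOrder : SmallWithin budget fun a : α => padOrder (Context.word a) :=
  smallWithin_palette.mul smallWithin_classSize

theorem decidableWithin_padAdj (hf : ComputableWithin budget f) (hg : ComputableWithin budget g) :
    DecidableWithin budget fun a => PadAdj (Context.word a) (f a) (g a) :=
  (decidableWithin_adj hf hg).or ((DecidableWithin.le computableWithin_order hf).and
    ((DecidableWithin.le computableWithin_order hg).and (DecidableWithin.eq hf hg).not))

theorem computableWithin_color (hf : ComputableWithin budget f) (hg : ComputableWithin budget g) :
    ComputableWithin budget fun a => color (Context.word a) (f a) (g a) :=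
  computableWithin_digit smallWithin_modSize.1 hf (computableWithin_rank hg)

theorem decidableWithin_proper (hf : ComputableWithin budget f) :
    DecidableWithin budget fun a => Proper (Context.word a) (f a) :=
  .forall_lt smallWithin_order
    (R := fun a u => InModulator (Context.word a) u →
      color (Context.word a) (f a) u < palette (Context.word a) ∧
        ∀ v < order (Context.word a), InModulator (Context.word a) v → Adj (Context.word a) u v →
          color (Context.word a) (f a) u ≠ color (Context.word a) (f a) v)
    ((decidableWithin_inModulator .last).imp
      ((DecidableWithin.lt (computableWithin_color hf.weaken .last) smallWithin_palette.1).and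
        (.forall_lt smallWithin_order (α := α × ℕ)
          (R := fun p v => InModulator (Context.word p) v → Adj (Context.word p) p.2 v →
            color (Context.word p) (f p.1) p.2 ≠ color (Context.word p) (f p.1) v)
          ((decidableWithin_inModulator .last).imp ((decidableWithin_adj .last₂ .last).imp
            (DecidableWithin.eq (computableWithin_color hf.weaken.weaken .last₂)
              (computableWithin_color hf.weaken.weaken .last)).not)))))

theorem decidableWithin_inSet (hf : ComputableWithin budget f) (hg : ComputableWithin budget g)
    (hh : ComputableWithin budget h) :
    DecidableWithin budget fun a => InSet (Context.word a) (f a) (g a) (h a) :=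
  ((DecidableWithin.lt hh smallWithin_modSize.1).and
    (.eq (computableWithin_digit (.const 2) hf hh) (.const 1))).or
  ((DecidableWithin.le smallWithin_modSize.1 hh).and
    (.lt hh (smallWithin_modSize.1.add hg)))

theorem decidableWithin_subsetCode (h₁ : ComputableWithin budget f₁)
    (h₂ : ComputableWithin budget f₂) (h₃ : ComputableWithin budget f₃)
    (h₄ : ComputableWithin budget f₄) :
    DecidableWithin budget fun a => SubsetCode (Context.word a) (f₁ a) (f₂ a) (f₃ a) (f₄ a) :=
  .forall_lt smallWithin_palette
    (R := fun a c => InSet (Context.word a) (f₃ a) (f₄ a) c →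
      InSet (Context.word a) (f₁ a) (f₂ a) c)
    ((decidableWithin_inSet h₃.weaken h₄.weaken .last).imp
      (decidableWithin_inSet h₁.weaken h₂.weaken .last))

theorem decidableWithin_free (hf : ComputableWithin budget f) (hg : ComputableWithin budget g)
    (hh : ComputableWithin budget h) :
    DecidableWithin budget fun a => Free (Context.word a) (f a) (g a) (h a) :=
  .forall_lt smallWithin_order
    (R := fun a u => InModulator (Context.word a) u → color (Context.word a) (f a) u = h a →
      ¬PadAdj (Context.word a) u (g a))
    ((decidableWithin_inModulator .last).imp
      ((DecidableWithin.eq (computableWithin_color hf.weaken .last) hh.weaken).imp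
        (decidableWithin_padAdj .last hg.weaken).not))

theorem decidableWithin_representsClique (hf : ComputableWithin budget f) :
    DecidableWithin budget fun a => RepresentsClique (Context.word a) (f a) :=
  (decidableWithin_inModulator hf).not.and (.forall_lt smallWithin_padOrder
    (R := fun a u => u < f a → ¬InModulator (Context.word a) u →
      ¬PadAdj (Context.word a) u (f a))
    ((DecidableWithin.lt .last hf.weaken).imp ((decidableWithin_inModulator .last).not.imp
      (decidableWithin_padAdj .last hf.weaken).not)))

theorem decidableWithin_inClique (hf : ComputableWithin budget f) (hg : ComputableWithin budget g) :
    DecidableWithin budget fun a => InClique (Context.word a) (f a) (g a) :=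
  (decidableWithin_inModulator hg).not.and
    ((DecidableWithin.eq hg hf).or (decidableWithin_padAdj hf hg))

open Classical in
theorem computableWithin_shortage (h₁ : ComputableWithin budget f₁)
    (h₂ : ComputableWithin budget f₂) (h₃ : ComputableWithin budget f₃)
    (h₄ : ComputableWithin budget f₄) :
    ComputableWithin budget fun a => shortage (Context.word a) (f₁ a) (f₂ a) (f₃ a) (f₄ a) :=
  (ComputableWithin.card_filter smallWithin_palette
    (R := fun a c => InSet (Context.word a) (f₃ a) (f₄ a) c)
    (decidableWithin_inSet h₃.weaken h₄.weaken .last)).sub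
  (.card_filter smallWithin_padOrder
    (R := fun a v => InClique (Context.word a) (f₂ a) v ∧
      ∃ c < palette (Context.word a), InSet (Context.word a) (f₃ a) (f₄ a) c ∧
        Free (Context.word a) (f₁ a) v c)
    ((decidableWithin_inClique h₂.weaken .last).and
      (.exists_lt smallWithin_palette (α := α × ℕ)
        (R := fun p c => InSet (Context.word p) (f₃ p.1) (f₄ p.1) c ∧
          Free (Context.word p) (f₁ p.1) p.2 c)
        ((decidableWithin_inSet h₃.weaken.weaken h₄.weaken.weaken .last).and
          (decidableWithin_free h₁.weaken.weaken .last₂ .last)))))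

open Classical in
theorem computableWithin_cliqueDeficiency (h₁ : ComputableWithin budget f₁)
    (h₂ : ComputableWithin budget f₂) (h₃ : ComputableWithin budget f₃)
    (h₄ : ComputableWithin budget f₄) :
    ComputableWithin budget fun a =>
      cliqueDeficiency (Context.word a) (f₁ a) (f₂ a) (f₃ a) (f₄ a) :=
  .sup smallWithin_setCodes
    (h := fun a t => (range (palette (Context.word a) + 1)).sup fun i =>
      if SubsetCode (Context.word a) (f₂ a) (f₃ a) t i
      then shortage (Context.word a) (f₁ a) (f₄ a) t i else 0)
    (.sup (smallWithin_palette.add (.const 1)) (α := α × ℕ)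
      (h := fun p i => if SubsetCode (Context.word p) (f₂ p.1) (f₃ p.1) p.2 i
        then shortage (Context.word p) (f₁ p.1) (f₄ p.1) p.2 i else 0)
      (.ite (decidableWithin_subsetCode h₂.weaken.weaken h₃.weaken.weaken .last₂ .last)
        (computableWithin_shortage h₁.weaken.weaken h₄.weaken.weaken .last₂ .last) (.const 0)))

open Classical in
theorem computableWithin_colorSupply (hf : ComputableWithin budget f)
    (hg : ComputableWithin budget g) :
    ComputableWithin budget fun a => colorSupply (Context.word a) (f a) (g a) :=
  (ComputableWithin.card_filter smallWithin_padOrder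
    (R := fun a v => RepresentsClique (Context.word a) v)
    (decidableWithin_representsClique .last)).add
  (.card_filter smallWithin_order
    (R := fun a u => InModulator (Context.word a) u ∧ color (Context.word a) (f a) u = g a)
    ((decidableWithin_inModulator .last).and
      (.eq (computableWithin_color hf.weaken .last) hg.weaken)))

theorem computableWithin_sum_cliqueDeficiency (h₁ : ComputableWithin budget f₁)
    (h₂ : ComputableWithin budget f₂) (h₃ : ComputableWithin budget f₃)
    [∀ a : α, DecidablePred (RepresentsClique (Context.word a))] :
    ComputableWithin budget fun a => ∑ b ∈ range (padOrder (Context.word a)),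
      if RepresentsClique (Context.word a) b
      then cliqueDeficiency (Context.word a) (f₁ a) (f₂ a) (f₃ a) b else 0 :=
  .sum smallWithin_padOrder (.ite (decidableWithin_representsClique .last)
    (computableWithin_cliqueDeficiency h₁.weaken h₂.weaken h₃.weaken .last) (.const 0))

theorem computableWithin_sum_colorSupply (h₁ : ComputableWithin budget f₁)
    (h₂ : ComputableWithin budget f₂) (h₃ : ComputableWithin budget f₃)
    [∀ a : α, DecidablePred (InSet (Context.word a) (f₂ a) (f₃ a))] :
    ComputableWithin budget fun a => ∑ c ∈ range (palette (Context.word a)),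
      if InSet (Context.word a) (f₂ a) (f₃ a) c
      then colorSupply (Context.word a) (f₁ a) c - classSize (Context.word a) else 0 :=
  .sum smallWithin_palette (.ite (decidableWithin_inSet h₂.weaken h₃.weaken .last)
    ((computableWithin_colorSupply h₁.weaken .last).sub smallWithin_classSize.1) (.const 0))

open Classical in
theorem decidableWithin_extends (hf : ComputableWithin budget f) :
    DecidableWithin budget fun a => Extends (Context.word a) (f a) :=
  (DecidableWithin.forall_lt smallWithin_palette
    (R := fun a c => classSize (Context.word a) ≤ colorSupply (Context.word a) (f a) c)
    (.le smallWithin_classSize.1 (computableWithin_colorSupply hf.weaken .last))).and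
  (.forall_lt smallWithin_setCodes
    (R := fun a s => ∀ j < palette (Context.word a) + 1,
      (∑ b ∈ range (padOrder (Context.word a)), if RepresentsClique (Context.word a) b
        then cliqueDeficiency (Context.word a) (f a) s j b else 0) ≤
        ∑ c ∈ range (palette (Context.word a)), if InSet (Context.word a) s j c
          then colorSupply (Context.word a) (f a) c - classSize (Context.word a) else 0)
    (.forall_lt (smallWithin_palette.add (.const 1)) (α := α × ℕ)
      (R := fun p j =>
        (∑ b ∈ range (padOrder (Context.word p)), if RepresentsClique (Context.word p) b
          then cliqueDeficiency (Context.word p) (f p.1) p.2 j b else 0) ≤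
          ∑ c ∈ range (palette (Context.word p)), if InSet (Context.word p) p.2 j c
            then colorSupply (Context.word p) (f p.1) c - classSize (Context.word p) else 0)
      (.le (computableWithin_sum_cliqueDeficiency hf.weaken.weaken .last₂ .last)
        (computableWithin_sum_colorSupply hf.weaken.weaken .last₂ .last))))

theorem decidableWithin_accepts : DecidableWithin budget Accepts :=
  (DecidableWithin.le (α := List Bool) computableWithin_order computableWithin_colors).or
    ((DecidableWithin.lt (.const 0) computableWithin_colors).and
      (.exists_lt smallWithin_colorCodes (R := fun w y => Proper w y ∧ Extends w y)
        ((decidableWithin_proper .last).and (decidableWithin_extends .last))))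

theorem exists_prog_answersWithin_accepts : ∃ (p : Prog) (C D : ℕ), ∀ w,
    AnswersWithin p w (Accepts w) (C * (budget w + 1) ^ D) := by
  obtain ⟨p, T, ⟨C, D, hT⟩, hp⟩ := ComputableWithin.exists_prog decidableWithin_accepts
  refine ⟨p, C, D, fun w => ?_⟩
  obtain ⟨t, m', ht, hr, hv⟩ := hp w
  refine ⟨t, m', ht.trans (hT w), hr, ?_⟩
  by_cases h : Accepts w
  · exact .inl ⟨h, by rw [hv, if_pos h]⟩
  · exact .inr ⟨h, by rw [hv, if_neg h]⟩

end Computability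

variable {w : List Bool} {b i j s t u v x y : ℕ}

theorem Adj.symm (h : Adj w u v) : Adj w v u :=
  ⟨h.1.symm, h.2.2.1, h.2.1, h.2.2.2.symm⟩

theorem PadAdj.symm (h : PadAdj w u v) : PadAdj w v u :=
  h.imp Adj.symm fun h => ⟨h.2.1, h.1, h.2.2.symm⟩

/-- The graph described by the word. -/
def graph (w : List Bool) : SimpleGraph (Fin (order w)) where
  Adj u v := Adj w u v
  symm := ⟨fun _ _ => Adj.symm⟩
  loopless := ⟨fun _ h => h.1 rfl⟩

open Classical in
theorem order_le_length (w : List Bool) : order w ≤ w.length :=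
  (card_filter_le _ _).trans (card_range _).le

section Digits

theorem digit_eq (hw : 0 < w.length) (hb₀ : 0 < b) (hb : b ≤ w.length + 1)
    (hx : x < 2 ^ digitWidth w) (hi : i ≤ w.length + 1) : digit w b x i = x / b ^ i % b := by
  have hwidth : w.length + 1 ≤ digitWidth w := by rw [digitWidth]; nlinarith
  exact clippedDigit_eq hb₀ (hb.trans hwidth) hx (hi.trans hwidth)

theorem digit_two (hx : x < 2 ^ order w) (hv : v < order w) :
    digit w 2 x v = if x.testBit v then 1 else 0 := by
  have hlen := order_le_length w
  have hwidth : order w ≤ digitWidth w := hlen.trans (Nat.le_mul_of_pos_right _ (by omega))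
  rw [digit_eq (by omega) two_pos (by omega) (hx.trans_le (Nat.pow_le_pow_right two_pos hwidth))
    (by omega)]
  simp only [Nat.testBit_eq_decide_div_mod_eq, decide_eq_true_eq]
  split_ifs <;> omega

theorem entry_eq (ht : t < order w ^ 3) (hi : i < 3) :
    entry w t i = t / order w ^ i % order w := by
  have hlen := order_le_length w
  have horder : 0 < order w := Nat.pos_of_ne_zero fun h => by simp [h] at ht
  refine digit_eq (by omega) horder (by omega) (ht.trans_le ?_) (by omega)
  calc order w ^ 3 ≤ (2 ^ w.length) ^ 3 :=
      Nat.pow_le_pow_left (hlen.trans Nat.lt_two_pow_self.le) 3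
    _ = 2 ^ (w.length * 3) := (pow_mul ..).symm
    _ ≤ 2 ^ digitWidth w := Nat.pow_le_pow_right two_pos (Nat.mul_le_mul_left _ (by omega))

theorem exists_entry_eq {f : ℕ → ℕ} (hf : ∀ i < 3, f i < order w) :
    ∃ t < order w ^ 3, ∀ i < 3, entry w t i = f i := by
  obtain ⟨t, ht, h⟩ := exists_digits_eq fun i : Fin 3 => (⟨f i, hf i i.2⟩ : Fin (order w))
  exact ⟨t, ht, fun i hi => (entry_eq ht hi).trans (h ⟨i, hi⟩)⟩

end Digits

section Modulator

open Classical in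
/-- The vertex set of the triple `t` if this is an induced path on three vertices. -/
noncomputable def inducedPath (w : List Bool) (t : ℕ) : Finset ℕ :=
  if IsInducedPath w t then (range 3).image (entry w t) else ∅

/-- The set of vertices whose bit mask is `mask w`. -/
noncomputable def modulator (w : List Bool) : Finset ℕ :=
  greedyHittingSet (inducedPath w) (order w ^ 3)

theorem inducedPath_subset (t : ℕ) : inducedPath w t ⊆ range (order w) := by
  intro v hv
  rw [inducedPath] at hv
  split_ifs at hv with h
  · obtain ⟨h₀₁, h₁₂, -⟩ := h
    obtain ⟨i, hi, rfl⟩ := mem_image.1 hv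
    rw [mem_range] at hi ⊢
    interval_cases i
    exacts [h₀₁.2.1, h₁₂.2.1, h₁₂.2.2.1]
  · simp at hv

theorem IsInducedPath.injOn_entry (h : IsInducedPath w t) :
    Set.InjOn (entry w t) (range 3 : Finset ℕ) := by
  obtain ⟨h₀₁, h₁₂, -, h₀₂⟩ := h
  intro i hi j hj hij
  simp only [coe_range, Set.mem_Iio] at hi hj
  interval_cases i <;> interval_cases j <;>
    first | rfl | exact absurd hij h₀₁.1 | exact absurd hij h₁₂.1 | exact absurd hij h₀₂ |
      exact absurd hij.symm h₀₁.1 | exact absurd hij.symm h₁₂.1 | exact absurd hij.symm h₀₂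

theorem sum_two_pow_lt {U : Finset ℕ} (hU : U ⊆ range (order w)) :
    ∑ u ∈ U, 2 ^ u < 2 ^ order w :=
  Nat.geomSum_lt le_rfl fun _ hu => mem_range.1 (hU hu)

theorem digit_two_sum {U : Finset ℕ} (hU : U ⊆ range (order w)) (hv : v < order w) :
    digit w 2 (∑ u ∈ U, 2 ^ u) v = if v ∈ U then 1 else 0 := by
  simp only [digit_two (sum_two_pow_lt hU) hv, testBit_sum_two_pow]

theorem maskStep_sum {U : Finset ℕ} (hU : U ⊆ range (order w)) :
    maskStep w t (∑ u ∈ U, 2 ^ u) = ∑ u ∈ if Disjoint (inducedPath w t) U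
      then U ∪ inducedPath w t else U, 2 ^ u := by
  rw [maskStep]
  by_cases hpath : IsInducedPath w t
  · have himage : inducedPath w t = (range 3).image (entry w t) := if_pos hpath
    have havoids : Avoids w t (∑ u ∈ U, 2 ^ u) ↔ Disjoint (inducedPath w t) U := by
      rw [himage, disjoint_left, forall_mem_image]
      refine forall_congr' fun i => ?_
      rw [mem_range]
      refine forall_congr' fun hi => ?_
      have hmem : entry w t i ∈ inducedPath w t :=
        himage ▸ mem_image_of_mem _ (mem_range.2 hi)
      rw [digit_two_sum hU (mem_range.1 (inducedPath_subset t hmem))]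
      simp only [ite_eq_right_iff, one_ne_zero, imp_false]
    simp only [hpath, havoids, true_and]
    split_ifs with h
    · rw [sum_union h.symm, himage, sum_image hpath.injOn_entry]
    · rfl
  · have hempty : inducedPath w t = ∅ := if_neg hpath
    simp [hpath, hempty]

theorem mask_eq_sum : mask w = ∑ u ∈ modulator w, 2 ^ u := by
  rw [mask, modulator]
  induction order w ^ 3 with
  | zero => rfl
  | succ t ih =>
    rw [greedyHittingSet, ← maskStep_sum (greedyHittingSet_subset inducedPath_subset t), ← ih]

theorem inModulator_iff : InModulator w v ↔ v ∈ modulator w := by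
  have hsub : modulator w ⊆ range (order w) := greedyHittingSet_subset inducedPath_subset _
  refine ⟨fun ⟨hv, h⟩ => ?_, fun h => ⟨mem_range.1 (hsub h), ?_⟩⟩
  · rw [mask_eq_sum, digit_two_sum hsub hv] at h
    by_contra hmem
    simp [hmem] at h
  · rw [mask_eq_sum, digit_two_sum hsub (mem_range.1 (hsub h)), if_pos h]

theorem inModulator_or_of_adj_of_adj (huv : Adj w u v) (hvx : Adj w v x) (hux : ¬Adj w u x)
    (hne : u ≠ x) : InModulator w u ∨ InModulator w v ∨ InModulator w x := by
  obtain ⟨t, ht, h⟩ := exists_entry_eq (w := w)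
    (f := fun i => if i = 0 then u else if i = 1 then v else x) fun i _ => by
      split_ifs
      exacts [huv.2.1, hvx.2.1, hvx.2.2.1]
  have h₀ : entry w t 0 = u := h 0 (by omega)
  have h₁ : entry w t 1 = v := h 1 (by omega)
  have h₂ : entry w t 2 = x := h 2 (by omega)
  have himage : inducedPath w t = (range 3).image (entry w t) :=
    if_pos (by rw [IsInducedPath, h₀, h₁, h₂]; exact ⟨huv, hvx, hux, hne⟩)
  have hhit := not_disjoint_greedyHittingSet ht (P := inducedPath w)
    (by rw [himage]; exact ⟨_, mem_image_of_mem _ (mem_range.2 three_pos)⟩)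
  rw [himage, not_disjoint_iff] at hhit
  obtain ⟨_, hmem, hmod⟩ := hhit
  obtain ⟨i, hi, rfl⟩ := mem_image.1 hmem
  rw [mem_range] at hi
  replace hmod := inModulator_iff.2 hmod
  interval_cases i
  · exact .inl (h₀ ▸ hmod)
  · exact .inr (.inl (h₁ ▸ hmod))
  · exact .inr (.inr (h₂ ▸ hmod))

theorem modSize_eq_card : modSize w = #(modulator w) := by
  rw [modSize, Nat.count_eq_card_filter_range]
  refine congrArg card ?_
  ext v
  simp only [mem_filter, mem_range, ← inModulator_iff]
  exact ⟨And.right, fun h => ⟨h.1, h⟩⟩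

theorem not_disjoint_inducedPath {U : Finset (Fin (order w))}
    (hU : ((graph w).induce (U : Set _)ᶜ).IsCluster) (ht : (inducedPath w t).Nonempty) :
    ¬Disjoint (inducedPath w t) (U.map Fin.valEmbedding) := by
  have hpath : IsInducedPath w t := by
    by_contra h
    simp [inducedPath, h] at ht
  have himage : inducedPath w t = (range 3).image (entry w t) := if_pos hpath
  obtain ⟨h₀₁, h₁₂, h₀₂, hne⟩ := hpath
  intro hdisj
  have hmem {i : ℕ} (hi : i < 3) (hlt : entry w t i < order w) :
      (⟨_, hlt⟩ : Fin (order w)) ∈ (U : Set (Fin (order w)))ᶜ := fun h =>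
    disjoint_left.1 hdisj (himage ▸ mem_image_of_mem _ (mem_range.2 hi))
      (mem_map_of_mem Fin.valEmbedding h)
  refine h₀₂ (isCluster_iff_adj_trans.1 hU ⟨_, hmem (i := 0) (by omega) h₀₁.2.1⟩
    ⟨_, hmem (i := 1) (by omega) h₁₂.2.1⟩ ⟨_, hmem (i := 2) (by omega) h₁₂.2.2.1⟩ h₀₁ h₁₂ ?_)
  exact fun h => hne (congrArg (fun v => (v.1 : ℕ)) h)

theorem modSize_le (w : List Bool) : modSize w ≤ 3 * (graph w).distToCluster := by
  obtain ⟨U, hcard, hU⟩ : ∃ U : Finset (Fin (order w)), #U = (graph w).distToCluster ∧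
      ((graph w).induce (U : Set _)ᶜ).IsCluster := by
    refine Nat.sInf_mem (s := {d | ∃ U : Finset (Fin (order w)), #U = d ∧
      ((graph w).induce (U : Set _)ᶜ).IsCluster})
      ⟨_, univ, rfl, isCluster_iff_adj_trans.2 fun u => ?_⟩
    exact absurd (mem_coe.2 (mem_univ u.1)) u.2
  have hcard_path (t : ℕ) : #(inducedPath w t) ≤ 3 := by
    rw [inducedPath]
    split_ifs
    exacts [card_image_le, by simp]
  rw [modSize_eq_card, ← hcard, ← card_map Fin.valEmbedding]
  exact (card_greedyHittingSet_le hcard_path (fun _ => not_disjoint_inducedPath hU) _).trans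
    (Nat.mul_le_mul_left _ (card_le_card inter_subset_right))

end Modulator

section Padding

theorem palette_pos (hlt : colors w < order w) (hpos : 0 < colors w) : 0 < palette w :=
  lt_min hpos (hpos.trans hlt)

theorem classSize_eq (hk : 0 < palette w) : classSize w = order w ⌈/⌉ palette w := by
  rw [classSize, ← card_range (order w ⌈/⌉ palette w)]
  refine congrArg card ?_
  ext i
  have hiff : i < order w ⌈/⌉ palette w ↔ palette w * i < order w := by
    rw [← not_le, ceilDiv_le_iff_le_mul hk, not_le]
  rw [mem_filter, mem_range, mem_range, hiff]
  exact ⟨And.right, fun h => ⟨(Nat.le_mul_of_pos_left i hk).trans_lt h, h⟩⟩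

theorem order_le_padOrder (hk : 0 < palette w) : order w ≤ padOrder w := by
  rw [padOrder, classSize_eq hk, ← smul_eq_mul]
  exact le_smul_ceilDiv hk

/-- The graph with all color classes of equal size: the input graph and a disjoint clique. -/
def paddedGraph (w : List Bool) : SimpleGraph (Fin (padOrder w)) where
  Adj u v := PadAdj w u v
  symm := ⟨fun _ _ => PadAdj.symm⟩
  loopless := ⟨fun _ h => h.elim (fun h => h.1 rfl) fun h => h.2.2 rfl⟩

theorem nonempty_graph_sum_iso_paddedGraph (hk : 0 < palette w) :
    Nonempty ((graph w ⊕g (⊤ : SimpleGraph (Fin (padOrder w - order w)))) ≃g paddedGraph w) := by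
  refine ⟨⟨finSumFinEquiv.trans (finCongr (Nat.add_sub_cancel' (order_le_padOrder hk))), ?_⟩⟩
  rintro (u | u) (v | v)
  · simp [paddedGraph, PadAdj, graph]
  · simp [paddedGraph, PadAdj, Adj]
  · simp [paddedGraph, PadAdj, Adj]
  · simp [paddedGraph, PadAdj, Adj, Fin.ext_iff]

theorem equitablyColorable_graph_iff (hlt : colors w < order w) (hpos : 0 < colors w) :
    (graph w).EquitablyColorable (colors w) ↔
      ∃ ψ : (paddedGraph w).Coloring (Fin (palette w)),
        ∀ c, {v | ψ v = c}.ncard = classSize w := by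
  have hk := palette_pos hlt hpos
  obtain ⟨e⟩ := nonempty_graph_sum_iso_paddedGraph hk
  have hpalette : colors w = palette w := (min_eq_left hlt.le).symm
  rw [hpalette, equitablyColorable_iff_exists_exact_coloring
    (W := Fin (padOrder w - order w)) hk (by
      rw [Fintype.card_fin, Fintype.card_fin, Nat.add_sub_cancel' (order_le_padOrder hk), padOrder,
        classSize_eq hk]), Fintype.card_fin, ← classSize_eq hk]
  exact exists_coloring_forall_ncard_congr e (· = classSize w)

end Padding

section ModulatorColoring

/-- The vertices of the modulator in the padded graph. -/
def modulatorSet (w : List Bool) : Set (Fin (padOrder w)) := {v | InModulator w v}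

theorem isCluster_induce_compl_modulatorSet (w : List Bool) :
    ((paddedGraph w).induce (modulatorSet w)ᶜ).IsCluster := by
  refine isCluster_iff_adj_trans.2 fun a b c hab hbc hac => ?_
  have hne : (a.1 : ℕ) ≠ c.1 := fun h => hac (Subtype.ext (Fin.ext h))
  rcases hab with hab | hab <;> rcases hbc with hbc | hbc
  · by_contra h
    rcases inModulator_or_of_adj_of_adj hab hbc (fun h' => h (.inl h')) hne with h | h | h
    exacts [a.2 h, b.2 h, c.2 h]
  · exact absurd hab.2.2.1 hbc.1.not_gt
  · exact absurd hbc.2.1 hab.2.1.not_gt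
  · exact .inr ⟨hab.1, hbc.2.1, hne⟩

theorem ncard_modulatorSet_le (w : List Bool) : (modulatorSet w).ncard ≤ modSize w := by
  rw [modSize_eq_card, ← Set.ncard_coe_finset]
  exact Set.ncard_le_ncard_of_injOn Fin.val (fun v hv => inModulator_iff.1 hv)
    Fin.val_injective.injOn

theorem color_lt (hv : InModulator w v) : color w y v < modSize w := by
  have hpos : 0 < modSize w := (modSize_eq_card (w := w)) ▸ card_pos.2 ⟨v, inModulator_iff.1 hv⟩
  exact (Nat.mod_lt _ (by omega)).trans_le (max_le hpos (min_le_left ..))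

open Classical in
theorem modSize_le_order (w : List Bool) : modSize w ≤ order w := Nat.count_le _

theorem colorCodes_le (w : List Bool) : colorCodes w ≤ 2 ^ digitWidth w :=
  have hlen := (modSize_le_order w).trans (order_le_length w)
  calc modSize w ^ modSize w ≤ (2 ^ w.length) ^ modSize w :=
      Nat.pow_le_pow_left (hlen.trans Nat.lt_two_pow_self.le) _
    _ ≤ (2 ^ w.length) ^ (w.length + 3) :=
      Nat.pow_le_pow_right Nat.one_le_two_pow (hlen.trans (Nat.le_add_right _ 3))
    _ = 2 ^ digitWidth w := (pow_mul ..).symm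

open Classical in
theorem exists_color_eq {f : ℕ → ℕ} (hf : ∀ v < order w, InModulator w v → f v < modSize w) :
    ∃ y < colorCodes w, ∀ v, InModulator w v → color w y v = f v := by
  obtain ⟨y, hy, h⟩ := exists_digits_count_eq hf
  have hlen := order_le_length w
  have hmod := modSize_le_order w
  refine ⟨y, hy, fun v hv => (digit_eq ?_ (hf v hv.1 hv).pos (by omega)
    (hy.trans_le (colorCodes_le w)) ?_).trans (h v hv.1 hv)⟩
  · exact hv.1.pos.trans_le hlen
  · have hrank : rank w v ≤ v := Nat.count_le _
    have hv_lt := hv.1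
    omega

/-- The coloring of the modulator with code `y`. -/
noncomputable def Proper.coloring (h : Proper w y) :
    ((paddedGraph w).induce (modulatorSet w)).Coloring (Fin (palette w)) :=
  .mk (fun u => ⟨color w y u, (h u u.2.1 u.2).1⟩) fun {u v} huv heq =>
    (h u u.2.1 u.2).2 v v.2.1 v.2
      (huv.resolve_right fun h => h.1.not_gt u.2.1) (congrArg Fin.val heq)

theorem exists_proper_of_coloring
    (χ : ((paddedGraph w).induce (modulatorSet w)).Coloring (Fin (palette w)))
    (hk : 0 < palette w) (hχ : ∀ u, (χ u : ℕ) < modSize w) :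
    ∃ y < colorCodes w, ∃ h : Proper w y, h.coloring = χ := by
  have hpad {v : ℕ} (hv : InModulator w v) : v < padOrder w := hv.1.trans_le (order_le_padOrder hk)
  classical
  obtain ⟨y, hy, hcolor⟩ := exists_color_eq (w := w)
    (f := fun v => if h : InModulator w v then χ ⟨⟨v, hpad h⟩, h⟩ else 0)
    fun v _ hv => by rw [dif_pos hv]; exact hχ _
  replace hcolor (v : ℕ) (hv : InModulator w v) : color w y v = χ ⟨⟨v, hpad hv⟩, hv⟩ :=
    (hcolor v hv).trans (dif_pos hv)
  refine ⟨y, hy, fun u _ hu => ⟨hcolor u hu ▸ Fin.isLt _, fun v _ hv huv heq => ?_⟩, ?_⟩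
  · rw [hcolor u hu, hcolor v hv] at heq
    exact χ.valid (v := ⟨⟨u, hpad hu⟩, hu⟩) (w := ⟨⟨v, hpad hv⟩, hv⟩) (.inl huv) (Fin.ext heq)
  · exact RelHom.ext fun u => Fin.ext (hcolor u u.2)

end ModulatorColoring

section ColorSets

theorem mem_codeSet_iff_inSet (hs : s < setCodes w) {c : Fin (palette w)} :
    c ∈ codeSet (palette w) (modSize w) s j ↔ InSet w s j c := by
  have hs' : s < 2 ^ order w :=
    hs.trans_le (Nat.pow_le_pow_right two_pos (modSize_le_order w))
  rw [mem_codeSet, InSet]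
  split_ifs with hc
  · rw [digit_two hs' (hc.trans_le (modSize_le_order w))]
    simp [hc, hc.not_ge]
  · simp [hc, not_lt.1 hc]

open Classical in
theorem map_codeSet (hs : s < setCodes w) :
    (codeSet (palette w) (modSize w) s j).map Fin.valEmbedding =
      {c ∈ range (palette w) | InSet w s j c} := by
  ext c
  simp only [mem_map, Fin.valEmbedding_apply, mem_filter, mem_range]
  constructor
  · rintro ⟨c, hc, rfl⟩
    exact ⟨c.2, (mem_codeSet_iff_inSet hs).1 hc⟩
  · rintro ⟨hc, hmem⟩
    exact ⟨⟨c, hc⟩, (mem_codeSet_iff_inSet hs).2 hmem, rfl⟩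

theorem subsetCode_iff (hs : s < setCodes w) (ht : t < setCodes w) :
    SubsetCode w s j t i ↔
      codeSet (palette w) (modSize w) t i ⊆ codeSet (palette w) (modSize w) s j := by
  simp only [subset_iff, mem_codeSet_iff_inSet hs, mem_codeSet_iff_inSet ht]
  exact ⟨fun h c => h c c.2, fun h c hc => @h ⟨c, hc⟩⟩

end ColorSets

section Hall

/-- The graph left after deleting the modulator from the padded graph. -/
abbrev restGraph (w : List Bool) : SimpleGraph ((modulatorSet w)ᶜ : Set _) :=
  (paddedGraph w).induce (modulatorSet w)ᶜ

theorem sum_compl_modulatorSet {A : Type*} [AddCommMonoid A] (p : ℕ → Prop) (f : ℕ → A)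
    [DecidablePred p] [DecidablePred (InModulator w)] [Fintype ((modulatorSet w)ᶜ : Set _)] :
    ∑ v ∈ univ.filter fun v : ((modulatorSet w)ᶜ : Set _) => p v, f v =
      ∑ v ∈ range (padOrder w) with ¬InModulator w v ∧ p v, f v :=
  sum_bij (fun v _ => v) (fun v hv => by
      simp only [mem_filter, mem_range]
      exact ⟨v.1.2, v.2, (mem_filter.1 hv).2⟩)
    (fun u _ v _ h => Subtype.ext (Fin.ext h)) (fun v hv => by
      simp only [mem_filter, mem_range] at hv
      exact ⟨⟨⟨v, hv.1⟩, hv.2.1⟩, mem_filter.2 ⟨mem_univ _, hv.2.2⟩, rfl⟩) fun _ _ => rfl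

theorem representsClique_iff {a : ((modulatorSet w)ᶜ : Set _)} :
    RepresentsClique w a ↔ ∀ u < a, ¬(restGraph w).Adj u a :=
  ⟨fun h u hlt => h.2 u u.1.2 hlt u.2, fun h => ⟨a.2, fun u hu hlt hmod =>
    h ⟨⟨u, hu⟩, hmod⟩ hlt⟩⟩

open Classical in
theorem sum_connectedComponent {A : Type*} [AddCommMonoid A]
    (f : (restGraph w).ConnectedComponent → A) (g : ℕ → A)
    (hfg : ∀ a : ((modulatorSet w)ᶜ : Set _), g a = f ((restGraph w).connectedComponentMk a)) :
    ∑ C, f C = ∑ a ∈ range (padOrder w), if RepresentsClique w a then g a else 0 := by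
  rw [sum_connectedComponent_of_isCluster (isCluster_induce_compl_modulatorSet w)]
  simp only [← hfg, ← representsClique_iff, ← sum_filter]
  rw [sum_compl_modulatorSet (RepresentsClique w) g]
  exact sum_congr (filter_congr fun a _ => and_iff_right_of_imp And.left) fun _ _ => rfl

theorem card_connectedComponent (w : List Bool) :
    Nat.card (restGraph w).ConnectedComponent = cliqueCount w := by
  classical
  rw [Nat.card_eq_fintype_card, ← card_univ, card_eq_sum_ones,
    sum_connectedComponent _ (fun _ => 1) fun _ => rfl, cliqueCount, card_filter]

variable (h : Proper w y)

theorem Proper.isFree_iff {v : ((modulatorSet w)ᶜ : Set _)} {c : Fin (palette w)}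
    (hk : 0 < palette w) :
    IsFree h.coloring v c ↔ Free w y v c :=
  ⟨fun hfree u hu hmod hcolor =>
      hfree ⟨⟨u, hu.trans_le (order_le_padOrder hk)⟩, hmod⟩ (Fin.ext hcolor),
    fun hfree u hcolor => hfree u u.2.1 u.2 (congrArg Fin.val hcolor)⟩

theorem Proper.supply_eq (hk : 0 < palette w) (c : Fin (palette w)) :
    supply h.coloring c = colorSupply w y c := by
  rw [supply, card_connectedComponent, colorSupply, ← Set.ncard_coe_finset]
  refine congrArg _ (Set.ncard_congr (fun u _ => u) (fun u hu => ?_)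
    (fun u v _ _ huv => Subtype.ext (Fin.ext huv)) fun u hu => ?_)
  · simp only [coe_filter, mem_range]
    exact ⟨u.2.1, u.2, congrArg Fin.val hu⟩
  · simp only [coe_filter, mem_range] at hu
    exact ⟨⟨⟨u, hu.1.trans_le (order_le_padOrder hk)⟩, hu.2.1⟩, Fin.ext hu.2.2, rfl⟩

theorem inClique_iff {a v : ((modulatorSet w)ᶜ : Set _)} :
    InClique w a v ↔ (restGraph w).connectedComponentMk v =
      (restGraph w).connectedComponentMk a := by
  rw [eq_comm, connectedComponentMk_eq_iff_of_isCluster (isCluster_induce_compl_modulatorSet w),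
    eq_comm (a := a), Subtype.ext_iff, Fin.ext_iff]
  exact and_iff_right v.2

open Classical in
theorem Proper.card_candidates (hk : 0 < palette w) (ht : t < setCodes w)
    (a : ((modulatorSet w)ᶜ : Set _)) :
    #(candidates (restGraph w).connectedComponentMk (IsFree h.coloring)
        ((restGraph w).connectedComponentMk a) (codeSet (palette w) (modSize w) t i)) =
      #{v ∈ range (padOrder w) |
        InClique w a v ∧ ∃ c < palette w, InSet w t i c ∧ Free w y v c} := by
  have hset (v : ((modulatorSet w)ᶜ : Set _)) :
      (∃ c ∈ codeSet (palette w) (modSize w) t i, IsFree h.coloring v c) ↔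
        ∃ c < palette w, InSet w t i c ∧ Free w y v c := by
    simp only [mem_codeSet_iff_inSet ht, h.isFree_iff hk]
    exact ⟨fun ⟨c, hc⟩ => ⟨c, c.2, hc⟩, fun ⟨c, hlt, hc⟩ => ⟨⟨c, hlt⟩, hc⟩⟩
  simp only [candidates, ← inClique_iff, hset, card_eq_sum_ones]
  rw [sum_compl_modulatorSet (fun v => InClique w a v ∧ ∃ c < palette w,
    InSet w t i c ∧ Free w y v c) fun _ => 1]
  exact sum_congr (filter_congr fun v _ => and_iff_right_of_imp fun h => h.1.1) fun _ _ => rfl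

open Classical in
theorem Proper.deficiency_eq (hk : 0 < palette w) (hs : s < setCodes w)
    (a : ((modulatorSet w)ᶜ : Set _)) :
    cliqueDeficiency w y s j a = deficiency (codeSets (palette w) (modSize w))
      (restGraph w).connectedComponentMk (IsFree h.coloring)
      (codeSet (palette w) (modSize w) s j) ((restGraph w).connectedComponentMk a) := by
  refine eq_of_forall_ge_iff fun n => ?_
  rw [deficiency_le_iff, codeSets, forall_mem_image]
  simp only [cliqueDeficiency, Finset.sup_le_iff, mem_range, mem_product, Prod.forall, and_imp]
  have hshort {t i : ℕ} (ht : t < setCodes w) : shortage w y a t i ≤ n ↔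
      #(codeSet (palette w) (modSize w) t i) ≤ #(candidates (restGraph w).connectedComponentMk
        (IsFree h.coloring) ((restGraph w).connectedComponentMk a)
        (codeSet (palette w) (modSize w) t i)) + n := by
    rw [shortage, ← map_codeSet ht, card_map, ← h.card_candidates hk ht, tsub_le_iff_left]
  refine ⟨fun hle t i ht hi hsub => ?_, fun hle t ht i hi => ?_⟩
  · have hle_ti := hle t ht i hi
    rwa [if_pos ((subsetCode_iff hs ht).2 hsub), hshort ht] at hle_ti
  · split_ifs with hsub
    · exact (hshort ht).2 (hle t i ht hi ((subsetCode_iff hs ht).1 hsub))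
    · exact Nat.zero_le n

open Classical in
theorem Proper.hallCondition_codeSets_iff (hk : 0 < palette w) :
    HallCondition (codeSets (palette w) (modSize w)) (restGraph w).connectedComponentMk
        (IsFree h.coloring) (fun c => supply h.coloring c - classSize w) ↔
      ∀ s < setCodes w, ∀ j < palette w + 1,
        (∑ a ∈ range (padOrder w),
          if RepresentsClique w a then cliqueDeficiency w y s j a else 0) ≤
        ∑ c ∈ range (palette w),
          if InSet w s j c then colorSupply w y c - classSize w else 0 := by
  have hsum {s j : ℕ} (hs : s < setCodes w) :
      (∑ C, deficiency (codeSets (palette w) (modSize w)) (restGraph w).connectedComponentMk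
          (IsFree h.coloring) (codeSet (palette w) (modSize w) s j) C ≤
        ∑ c ∈ codeSet (palette w) (modSize w) s j, (supply h.coloring c - classSize w)) ↔
      (∑ a ∈ range (padOrder w),
          if RepresentsClique w a then cliqueDeficiency w y s j a else 0) ≤
        ∑ c ∈ range (palette w),
          if InSet w s j c then colorSupply w y c - classSize w else 0 := by
    rw [sum_connectedComponent _ (cliqueDeficiency w y s j) (h.deficiency_eq hk hs), ← sum_filter
      (fun c => InSet w s j c), ← map_codeSet hs, sum_map]
    simp only [h.supply_eq hk, Fin.valEmbedding_apply]
  rw [HallCondition]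
  nth_rw 1 [codeSets]
  simp only [forall_mem_image, mem_product, mem_range, Prod.forall, and_imp]
  exact ⟨fun hle s hs j hj => (hsum hs).1 (hle s j hs hj),
    fun hle s j hs hj => (hsum hs).2 (hle s hs j hj)⟩

theorem Proper.extends_iff (hk : 0 < palette w) :
    Extends w y ↔ ∃ ψ : (paddedGraph w).Coloring (Fin (palette w)),
      (∀ u : modulatorSet w, ψ u = h.coloring u) ∧ ∀ c, {v | ψ v = c}.ncard = classSize w := by
  classical
  have hlt (u : modulatorSet w) : (h.coloring u : ℕ) < modSize w := color_lt u.2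
  rw [exists_exact_extension_iff (isCluster_induce_compl_modulatorSet w)
      (by rw [Fintype.card_fin, Fintype.card_fin, padOrder]),
    hallCondition_univ_iff_codeSets (r := modSize w) (i := cliqueCount w - classSize w),
    h.hallCondition_codeSets_iff hk, Extends]
  · simp only [h.supply_eq hk, Fin.forall_iff]
  · exact fun v c hc u hu => absurd (hu ▸ hlt u) hc.not_gt
  · intro c hc
    rw [h.supply_eq hk, colorSupply, filter_false_of_mem, card_empty, add_zero]
    exact fun u _ hu => (color_lt hu.1).not_ge (hu.2 ▸ hc)

end Hall

theorem accepts_iff (w : List Bool) : Accepts w ↔ (graph w).EquitablyColorable (colors w) := by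
  rcases le_or_gt (order w) (colors w) with hle | hlt
  · exact iff_of_true (.inl hle) (equitablyColorable_of_card_le ((Fintype.card_fin _).trans_le hle))
  rw [Accepts, or_iff_right hlt.not_ge]
  rcases Nat.eq_zero_or_pos (colors w) with hzero | hpos
  · rw [hzero]
    exact iff_of_false (fun h => lt_irrefl _ h.1) fun ⟨φ, _⟩ =>
      (φ ⟨0, (Nat.zero_le _).trans_lt hlt⟩).elim0
  have hk := palette_pos hlt hpos
  rw [equitablyColorable_graph_iff hlt hpos, and_iff_right hpos]
  constructor
  · rintro ⟨y, -, hy, hext⟩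
    obtain ⟨ψ, -, hψ⟩ := (hy.extends_iff hk).1 hext
    exact ⟨ψ, hψ⟩
  · intro hψ
    obtain ⟨χ, hχ, hψ⟩ := (exists_exact_coloring_iff_exists_lt (ncard_modulatorSet_le w)).1 hψ
    obtain ⟨y, hlt, hy, rfl⟩ := exists_proper_of_coloring χ hk hχ
    exact ⟨y, hlt, hy, (hy.extends_iff hk).2 hψ⟩

section Encoding

theorem getD_flatMap {ι : Type*} {n : ℕ} (f : ι → List Bool) (hf : ∀ i, (f i).length = n)
    (l : List ι) (u v : ℕ) (hu : u < l.length) (hv : v < n) (d : Bool) :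
    (l.flatMap f).getD (n * u + v) d = (f l[u]).getD v d := by
  induction l generalizing u with
  | nil => simp at hu
  | cons a l ih =>
    rw [List.flatMap_cons]
    cases u with
    | zero => rw [List.getD_append _ _ _ _ (by rw [hf]; omega)]; simp
    | succ u =>
      rw [List.getD_append_right _ _ _ _ (by rw [hf, mul_add]; omega), hf,
        show n * (u + 1) + v - n = n * u + v by rw [mul_add]; omega,
        ih u (by simpa using hu), List.getElem_cons_succ]

theorem sum_bits {k m : ℕ} (hm : k.bits.length ≤ m) :
    (∑ i ∈ range m, if k.bits.getD i false = true then 2 ^ i else 0) = k := by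
  rw [← sum_filter]
  conv_rhs => rw [← Finset.sum_toFinset_bitIndices_two_pow k]
  refine sum_congr ?_ fun _ _ => rfl
  ext i
  rw [mem_filter, mem_range, List.mem_toFinset, Nat.mem_bitIndices, Nat.testBit_eq_inth,
    ← List.getD_default_eq_getI]
  refine ⟨fun h => h.2, fun h => ⟨?_, h⟩⟩
  by_contra hlt
  rw [List.getD_eq_default _ _ (by omega)] at h
  exact absurd h (by decide)

/-- The instance described by the word. -/
noncomputable def decode (w : List Bool) : EqColInstance := ⟨order w, graph w, colors w⟩

variable (x : EqColInstance)

theorem length_encode : x.encode.length = x.n + 1 + x.n * x.n + x.k.bits.length := by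
  simp only [EqColInstance.encode, List.length_append, List.length_replicate, List.length_cons,
    EqColInstance.length_adjBits]
  omega

theorem getD_encode_lt {i : ℕ} (hi : i < x.n) : x.encode.getD i false = true := by
  rw [EqColInstance.encode, List.getD_append _ _ _ _ (by simpa using hi),
    List.getD_replicate _ hi]

theorem getD_encode_self : x.encode.getD x.n false = false := by
  rw [EqColInstance.encode, List.getD_append_right _ _ _ _ (by simp)]
  simp

theorem getD_encode_add (i : ℕ) : x.encode.getD (x.n + 1 + i) false =
    (EqColInstance.adjBits x.G ++ x.k.bits).getD i false := by
  rw [EqColInstance.encode, List.getD_append_right _ _ _ _ (by rw [List.length_replicate]; omega),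
    List.length_replicate, show x.n + 1 + i - x.n = i + 1 by omega, List.getD_cons_succ]

theorem order_encode : order x.encode = x.n := by
  rw [order, ← card_range x.n]
  refine congrArg card ?_
  ext i
  have hlen := length_encode x
  simp only [mem_filter, mem_range]
  refine ⟨fun ⟨_, h⟩ => not_le.1 fun hi => ?_, fun hi => ⟨by omega, fun j _ hj =>
    getD_encode_lt x (hj.trans_lt hi)⟩⟩
  exact Bool.false_ne_true ((getD_encode_self x).symm.trans (h x.n (by omega) hi))

theorem bit_encode_adjBits {u v : ℕ} (hu : u < x.n) (hv : v < x.n) :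
    Bit x.encode (x.n + 1 + (x.n * u + v)) ↔ x.G.Adj ⟨u, hu⟩ ⟨v, hv⟩ := by
  rw [Bit, getD_encode_add, List.getD_append, EqColInstance.adjBits,
    getD_flatMap (n := x.n) _ (by simp) _ _ _ (by simpa using hu) hv]
  · simp [List.getD_eq_getElem?_getD, hv]
  · rw [EqColInstance.length_adjBits]
    nlinarith

theorem adj_encode {u v : ℕ} (hu : u < x.n) (hv : v < x.n) :
    Adj x.encode u v ↔ x.G.Adj ⟨u, hu⟩ ⟨v, hv⟩ := by
  rw [Adj, order_encode, bit_encode_adjBits x hu hv, bit_encode_adjBits x hv hu,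
    x.G.adj_comm ⟨v, _⟩, or_self]
  exact ⟨fun h => h.2.2.2, fun h => ⟨fun huv => h.ne (Fin.ext huv), hu, hv, h⟩⟩

theorem colors_encode : colors x.encode = x.k := by
  have hlen := length_encode x
  rw [colors]
  conv_rhs => rw [← sum_bits (k := x.k) (m := x.encode.length) (by omega)]
  refine sum_congr rfl fun i _ => ?_
  rw [Bit, order_encode, add_assoc (x.n + 1), getD_encode_add, List.getD_append_right _ _ _ _
    (by rw [EqColInstance.length_adjBits]; omega), EqColInstance.length_adjBits,
    Nat.add_sub_cancel_left]
  congr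

theorem graph_heq {w : List Bool} {n : ℕ} {G : SimpleGraph (Fin n)} (hn : order w = n)
    (hG : ∀ u v : Fin n, Adj w u v ↔ G.Adj u v) : graph w ≍ G := by
  subst hn
  exact heq_of_eq (SimpleGraph.ext (funext₂ fun u v => propext (hG u v)))

theorem decode_encode : decode x.encode = x :=
  (EqColInstance.mk.injEq ..).mpr ⟨order_encode x,
    graph_heq (order_encode x) fun u v => adj_encode x u.2 v.2, colors_encode x⟩

end Encoding

section RunningTime

theorem pow_self_add_two_pow_le {r d : ℕ} (h : r ≤ 3 * d) :
    1 + r ^ r + 2 ^ r ≤ 36 * d ^ (9 * d) := by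
  have hself : r ^ r ≤ (3 * d) ^ (3 * d) := by
    rcases Nat.eq_zero_or_pos d with rfl | hd
    · rw [Nat.le_zero.1 h]
    · exact (Nat.pow_le_pow_left h r).trans (Nat.pow_le_pow_right (by omega) h)
  have htwo : 2 ^ r ≤ 2 ^ (3 * d) := Nat.pow_le_pow_right two_pos h
  rcases Nat.lt_or_ge d 2 with hd | hd
  · interval_cases d <;> norm_num at hself htwo ⊢ <;> omega
  · have hself' : (3 * d) ^ (3 * d) ≤ d ^ (9 * d) :=
      calc (3 * d) ^ (3 * d) ≤ (d ^ 3) ^ (3 * d) :=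
          Nat.pow_le_pow_left (by rw [pow_succ]; exact Nat.mul_le_mul_right _ (by nlinarith)) _
        _ = d ^ (9 * d) := by rw [← pow_mul]; ring_nf
    have htwo' : 2 ^ (3 * d) ≤ d ^ (9 * d) :=
      (Nat.pow_le_pow_left hd _).trans (Nat.pow_le_pow_right (by omega) (by omega))
    have hone : 1 ≤ d ^ (9 * d) := Nat.one_le_pow _ _ (by omega)
    omega

theorem budget_add_one_le {d : ℕ} (h : modSize w ≤ 3 * d) :
    budget w + 1 ≤ 36 * d ^ (9 * d) * (w.length + 1) :=
  calc budget w + 1 ≤ (1 + colorCodes w + setCodes w) * (w.length + 1) := by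
        rw [budget]; nlinarith
    _ ≤ 36 * d ^ (9 * d) * (w.length + 1) := Nat.mul_le_mul_right _ (pow_self_add_two_pow_le h)

theorem mul_pow_le_of_le (C D : ℕ) {d L T : ℕ} (hT : T ≤ 36 * d ^ (9 * d) * (L + 1)) :
    C * T ^ D ≤ (C * 36 ^ D + 9 * D) * d ^ ((C * 36 ^ D + 9 * D) * d) * (L + 1) ^ D := by
  have hexp : d ^ (9 * D * d) ≤ d ^ ((C * 36 ^ D + 9 * D) * d) := by
    rcases Nat.eq_zero_or_pos d with rfl | hd
    · simp
    · exact Nat.pow_le_pow_right hd (Nat.mul_le_mul_right _ (by omega))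
  calc C * T ^ D ≤ C * (36 * d ^ (9 * d) * (L + 1)) ^ D := by gcongr
    _ = C * 36 ^ D * d ^ (9 * D * d) * (L + 1) ^ D := by
      rw [mul_pow, mul_pow, ← pow_mul, show 9 * d * D = 9 * D * d by ring]; ring
    _ ≤ _ := by gcongr; omega

theorem exists_solvableWith_mul_pow :
    ∃ a : ℕ, equitableColoringByDistToCluster.SolvableWith (fun d => a * d ^ (a * d)) := by
  obtain ⟨p, C, D, hp⟩ := exists_prog_answersWithin_accepts
  refine ⟨C * 36 ^ D + 9 * D, p, D, fun (x : EqColInstance) => ?_⟩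
  have hmod : modSize x.encode ≤ 3 * (decode x.encode).G.distToCluster := modSize_le _
  have hyes : Accepts x.encode ↔ (decode x.encode).G.EquitablyColorable (decode x.encode).k :=
    accepts_iff _
  rw [decode_encode] at hmod hyes
  obtain ⟨t, m', ht, hr, hanswer⟩ := hp x.encode
  rw [hyes] at hanswer
  exact ⟨t, m', ht.trans (mul_pow_le_of_le C D (budget_add_one_le hmod)), hr, hanswer⟩

theorem computable_mul_pow (a : ℕ) : Computable fun d : ℕ => a * d ^ (a * d) := by
  have hpow : Primrec₂ fun d e : ℕ => d ^ e := Primrec₂.unpaired'.1 Nat.Primrec.pow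
  exact (Primrec.nat_mul.comp (Primrec.const a) (hpow.comp Primrec.id
    (Primrec.nat_mul.comp (Primrec.const a) Primrec.id))).to_comp

end RunningTime

end EqColAlg

theorem mainTheorem1 :
    equitableColoringByDistToCluster.IsFPT ∧
      ∃ a : ℕ, equitableColoringByDistToCluster.SolvableWith (fun d => a * d ^ (a * d)) := by
  obtain ⟨a, ha⟩ := EqColAlg.exists_solvableWith_mul_pow
  exact ⟨⟨_, EqColAlg.computable_mul_pow a, ha⟩, a, ha⟩
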